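/- There are a randomized algorithm $\operatorname{Optimize}$ (one fixed program for a randomized real RAM) and constants $C,c$ such that the following holds for all integers $n,m\ge 1$ and $k\ge 0$. Let $v_1,\dots,v_m,v'\in\mathbb{R}^n$ and $\epsilon\in(0,1)$ be such that $\|v_j\|_2\le 1/2$ for all $j\in[m]$, $\|v'\|_2\le 1/2$, and $\max_{i\in[n]}\#\{j\in[m]:\langle v_j,e_i\rangle\neq 0\}\le k$. On input $v',v_1,\dots,v_m,\epsilon$, the algorithm always halts within time $$C\,\bigl((n+k)\epsilon^{-2}+m\bigr)\,\log^{c}(n+m+1),$$ that is, in time $\tilde O((n+k)\epsilon^{-2}+m)$, and with probability at least $1-1/n$ it outputs a point $x'\in[-1/\sqrt n,1/\sqrt n]^n$ such that $$\max_{j\in[m]}(v'+v_j)^{T}x'\;\le\;\epsilon+\min_{x\in[-1/\sqrt n,1/\sqrt n]^n}\ \max_{j\in[m]}(v'+v_j)^{T}x .$$ Here the machine performs each of the following at unit cost: exact real arithmetic ($+,-,\times,\div,\sqrt{\cdot}$) and comparison of reals; addition, subtraction and comparison of indices (natural numbers); access to an array entry through an index; the toss of a coin whose bias is a computed real number; and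 reading $n$, $m$, $\epsilon$, or one coordinate of $v'$ or of some $v_j$. As a data structure, for each $i\in[n]$ the set $\{j:\langle v_j,e_i\rangle\neq0\}$ is given as a list (in arbitrary order), whose length and whose individual entries can be read at unit cost each. -/

import Mathlib

open scoped NNReal ENNReal

noncomputable section

namespace RealRAM

/-! ## The minimax problem -/

/-- An instance of the minimax problem: vectors `v 0, ..., v (m-1)` and `v'` in Euclidean `n`-space,
the accuracy `eps`, and the data structure which lists, in an arbitrary order and without
repetition, the indices `j` of the vectors with a nonzero `i`-th coordinate. -/
structure Input (n m : ℕ) where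
  v' : EuclideanSpace ℝ (Fin n)
  v : Fin m → EuclideanSpace ℝ (Fin n)
  eps : ℝ
  supp : Fin n → List (Fin m)
  supp_nodup : ∀ i, (supp i).Nodup
  mem_supp : ∀ i j, j ∈ supp i ↔ v j i ≠ 0

/-- The scaled cube `[-1/√n, 1/√n]^n`. -/
def cube (n : ℕ) : Set (EuclideanSpace ℝ (Fin n)) :=
  {x | ∀ i, x i ∈ Set.Icc (-(1 / √(n : ℝ))) (1 / √(n : ℝ))}

/-- The objective function `x ↦ max_j (v' + v_j)ᵀ x` (a maximum over a finite set, nonempty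
as soon as `0 < m`). -/
def Input.objective {n m : ℕ} (I : Input n m) (x : EuclideanSpace ℝ (Fin n)) : ℝ :=
  ⨆ j : Fin m, inner ℝ (I.v' + I.v j) x

/-! ## A randomized real RAM

A machine has registers and random access arrays holding natural numbers, and registers and
random access arrays holding real numbers. A program is a fixed finite text; array and register
names in it are literals. The natural numbers are used for indices and counting; they can be added,
subtracted and compared, but a real number can never be rounded to a natural number. Real numbers
can be added, subtracted, multiplied, divided and compared, and square roots can be taken, all in
exact arithmetic. The only source of randomness is the toss of a coin with a prescribed bias. The
input is read entry by entry. Every elementary operation costs one unit of time. -/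

/-- Expressions for natural numbers. -/
inductive NatExpr where
  /-- a constant -/
  | const (c : ℕ)
  /-- the content of a register -/
  | reg (x : ℕ)
  /-- the entry with index `i` of the array `a` -/
  | arr (a : ℕ) (i : NatExpr)
  | add (e f : NatExpr)
  /-- truncated subtraction -/
  | sub (e f : NatExpr)
  /-- the dimension `n` -/
  | dim
  /-- the number `m` of vectors -/
  | num
  /-- the number of vectors with a nonzero `i`-th coordinate -/
  | colSize (i : NatExpr)
  /-- the index of the `l`-th vector in the list of those with a nonzero `i`-th coordinate -/
  | colAt (i l : NatExpr)

/-- Expressions for real numbers. -/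
inductive RealExpr where
  /-- a natural number, regarded as a real number -/
  | ofNat (e : NatExpr)
  /-- the content of a register -/
  | reg (x : ℕ)
  /-- the entry with index `i` of the array `a` -/
  | arr (a : ℕ) (i : NatExpr)
  | add (e f : RealExpr)
  | sub (e f : RealExpr)
  | mul (e f : RealExpr)
  /-- division (with value `0` if the denominator is `0`) -/
  | div (e f : RealExpr)
  /-- square root (with value `0` at negative numbers) -/
  | sqrt (e : RealExpr)
  /-- the accuracy -/
  | eps
  /-- the `i`-th coordinate of the vector `v'` -/
  | base (i : NatExpr)
  /-- the `i`-th coordinate of the vector `v_j` -/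
  | entry (j i : NatExpr)

/-- Tests. -/
inductive Test where
  | natLt (e f : NatExpr)
  | realLt (e f : RealExpr)
  | not (b : Test)
  | and (b c : Test)

/-- Programs. -/
inductive Prog where
  /-- assign to a register -/
  | setNat (x : ℕ) (e : NatExpr)
  | setReal (x : ℕ) (e : RealExpr)
  /-- assign to the entry with index `i` of the array `a` -/
  | storeNat (a : ℕ) (i e : NatExpr)
  | storeReal (a : ℕ) (i : NatExpr) (e : RealExpr)
  /-- toss a coin that shows heads with probability `p` (clamped to `[0, 1]`), and set a register
  to `1` for heads and to `0` for tails -/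
  | toss (x : ℕ) (p : RealExpr)
  | seq (P Q : Prog)
  | ite (b : Test) (P Q : Prog)
  | loop (b : Test) (P : Prog)

/-- The memory of the machine. -/
structure Memory where
  natReg : ℕ → ℕ
  realReg : ℕ → ℝ
  natArr : ℕ → ℕ → ℕ
  realArr : ℕ → ℕ → ℝ

/-- At the start, the whole memory is zero. -/
def Memory.init : Memory := ⟨fun _ => 0, fun _ => 0, fun _ _ => 0, fun _ _ => 0⟩

def Memory.setNat (s : Memory) (x c : ℕ) : Memory :=
  { s with natReg := Function.update s.natReg x c }

def Memory.setReal (s : Memory) (x : ℕ) (r : ℝ) : Memory :=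
  { s with realReg := Function.update s.realReg x r }

def Memory.storeNat (s : Memory) (a i c : ℕ) : Memory :=
  { s with natArr := Function.update s.natArr a (Function.update (s.natArr a) i c) }

def Memory.storeReal (s : Memory) (a i : ℕ) (r : ℝ) : Memory :=
  { s with realArr := Function.update s.realArr a (Function.update (s.realArr a) i r) }

/-- The output vector is read off the first `n` entries of the real array `0`. -/
def Memory.output (n : ℕ) (s : Memory) : EuclideanSpace ℝ (Fin n) :=
  WithLp.toLp 2 fun i : Fin n => s.realArr 0 i

/-! ### Values; indices outside of the range of the input give `0` -/

def NatExpr.eval {n m : ℕ} (I : Input n m) (s : Memory) : NatExpr → ℕ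
  | const c => c
  | reg x => s.natReg x
  | arr a i => s.natArr a (i.eval I s)
  | add e f => e.eval I s + f.eval I s
  | sub e f => e.eval I s - f.eval I s
  | dim => n
  | num => m
  | colSize i => if h : i.eval I s < n then (I.supp ⟨i.eval I s, h⟩).length else 0
  | colAt i l =>
      if h : i.eval I s < n then
        ((I.supp ⟨i.eval I s, h⟩).map Fin.val).getD (l.eval I s) 0
      else 0

def RealExpr.eval {n m : ℕ} (I : Input n m) (s : Memory) : RealExpr → ℝ
  | ofNat e => (e.eval I s : ℝ)
  | reg x => s.realReg x
  | arr a i => s.realArr a (i.eval I s)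
  | add e f => e.eval I s + f.eval I s
  | sub e f => e.eval I s - f.eval I s
  | mul e f => e.eval I s * f.eval I s
  | div e f => e.eval I s / f.eval I s
  | sqrt e => √(e.eval I s)
  | eps => I.eps
  | base i => if h : i.eval I s < n then I.v' ⟨i.eval I s, h⟩ else 0
  | entry j i =>
      if h : j.eval I s < m ∧ i.eval I s < n then I.v ⟨j.eval I s, h.1⟩ ⟨i.eval I s, h.2⟩ else 0

def Test.Holds {n m : ℕ} (I : Input n m) (s : Memory) : Test → Prop
  | natLt e f => e.eval I s < f.eval I s
  | realLt e f => e.eval I s < f.eval I s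
  | not b => ¬ b.Holds I s
  | and b c => b.Holds I s ∧ c.Holds I s

/-! ### Costs: the number of elementary operations in an expression or a test -/

def NatExpr.cost : NatExpr → ℕ
  | const _ => 1
  | reg _ => 1
  | arr _ i => i.cost + 1
  | add e f => e.cost + f.cost + 1
  | sub e f => e.cost + f.cost + 1
  | dim => 1
  | num => 1
  | colSize i => i.cost + 1
  | colAt i l => i.cost + l.cost + 1

def RealExpr.cost : RealExpr → ℕ
  | ofNat e => e.cost + 1
  | reg _ => 1
  | arr _ i => i.cost + 1
  | add e f => e.cost + f.cost + 1
  | sub e f => e.cost + f.cost + 1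
  | mul e f => e.cost + f.cost + 1
  | div e f => e.cost + f.cost + 1
  | sqrt e => e.cost + 1
  | eps => 1
  | base i => i.cost + 1
  | entry j i => j.cost + i.cost + 1

def Test.cost : Test → ℕ
  | natLt e f => e.cost + f.cost + 1
  | realLt e f => e.cost + f.cost + 1
  | not b => b.cost + 1
  | and b c => b.cost + c.cost + 1

/-! ### Execution -/

/-- The toss of a coin that shows heads (`true`) with probability `p`, clamped to `[0, 1]`. -/
def coin (p : ℝ) : PMF Bool :=
  PMF.ofFintype
    (fun b => bif b then ((min p.toNNReal 1 : ℝ≥0) : ℝ≥0∞)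
      else ((1 - min p.toNNReal 1 : ℝ≥0) : ℝ≥0∞))
    (by
      rw [Fintype.sum_bool, cond_true, cond_false, ← ENNReal.coe_add,
        add_tsub_cancel_of_le (min_le_right _ _), ENNReal.coe_one])

/-- A configuration: the commands that are still to be executed, in this order, the memory, and
the time used so far. -/
structure Config where
  todo : List Prog
  mem : Memory
  time : ℕ

open Classical in
/-- One step of the machine. -/
def step {n m : ℕ} (I : Input n m) : Config → PMF Config
  | ⟨[], s, t⟩ => PMF.pure ⟨[], s, t⟩
  | ⟨.setNat x e :: K, s, t⟩ => PMF.pure ⟨K, s.setNat x (e.eval I s), t + e.cost + 1⟩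
  | ⟨.setReal x e :: K, s, t⟩ => PMF.pure ⟨K, s.setReal x (e.eval I s), t + e.cost + 1⟩
  | ⟨.storeNat a i e :: K, s, t⟩ =>
      PMF.pure ⟨K, s.storeNat a (i.eval I s) (e.eval I s), t + i.cost + e.cost + 1⟩
  | ⟨.storeReal a i e :: K, s, t⟩ =>
      PMF.pure ⟨K, s.storeReal a (i.eval I s) (e.eval I s), t + i.cost + e.cost + 1⟩
  | ⟨.toss x p :: K, s, t⟩ =>
      (coin (p.eval I s)).map fun b => ⟨K, s.setNat x (bif b then 1 else 0), t + p.cost + 1⟩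
  | ⟨.seq P Q :: K, s, t⟩ => PMF.pure ⟨P :: Q :: K, s, t + 1⟩
  | ⟨.ite b P Q :: K, s, t⟩ =>
      PMF.pure ⟨(if b.Holds I s then P else Q) :: K, s, t + b.cost + 1⟩
  | ⟨.loop b P :: K, s, t⟩ =>
      PMF.pure ⟨if b.Holds I s then P :: .loop b P :: K else K, s, t + b.cost + 1⟩

/-- The distribution of the configuration after `N` further steps. -/
def run {n m : ℕ} (I : Input n m) : ℕ → Config → PMF Config
  | 0, c => PMF.pure c
  | N + 1, c => (step I c).bind (run I N)

/-- The initial configuration of a program. -/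
def Prog.start (P : Prog) : Config := ⟨[P], Memory.init, 0⟩

end RealRAM

end

open scoped NNReal ENNReal

namespace RealRAM

/-! ## Expectations of finitely many steps -/

/-! The minimax problem is played as a repeated game with step size `η = ε / 8`. The point `x` makes
projected gradient steps along `v' + v_l`, where `l` is drawn with probability proportional to the
weight `w_l`. The weights make multiplicative steps with the factor `1 + z_j + z_j²`, where `z_j = η
n v_j(i) x_i` for a uniformly drawn coordinate `i` is an unbiased estimate of `η ⟨v_j, x⟩`. The
output is the average of the points. A round changes only the weights in one column, so a tree of
partial sums with `m` leaves gives rounds of cost about `n + k log(n + m)`, and about `log(n + m) /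
ε²` rounds suffice.

The analysis uses one potential, `∑_j exp(E_j) · W / w_j` with `W = ∑ w`. Here `E_j` is `η` times
the accumulated excess of `(v' + v_j)ᵀ x` over the optimum, corrected by the squared distance from
`x` to a minimizer. The gradient step changes `E_j` by at most `η ⟨v_j, x⟩ - η ⟨v_l, x⟩`
(`exponent_next_le`; the contributions of `v'` cancel). The weight step changes the mean of `W /
w_j` by a factor that compensates this (`mean_ratio_le`). Since `l` and `i` are independent, the
mean of the potential grows by at most `exp(3 η²)` in a round (`mean_potential_le`). It starts at no
more than `m²` (`potential_start_le`) and is huge when the average is bad (`le_potential_of_bad`),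
so Markov's inequality bounds the failure probability by `1 / n` (`failure_bound`).

For the machine, `Bounded` controls the expectation of a payoff that is infinite on computations
which are unfinished or late. One finite bound therefore yields halting, the time limit and the
failure probability together. `main_spec` proves such a bound by backward induction on the remaining
rounds. -/

/-- The expectation of a nonnegative function. -/
noncomputable def expect {α : Type*} (p : PMF α) (f : α → ℝ≥0∞) : ℝ≥0∞ := ∑' a, p a * f a

theorem expect_pure {α : Type*} (a : α) (f : α → ℝ≥0∞) : expect (PMF.pure a) f = f a := by
  classical
  unfold expect
  rw [tsum_eq_single a (fun b hb => by simp [PMF.pure_apply, hb])]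
  simp

theorem expect_bind {α β : Type*} (p : PMF α) (q : α → PMF β) (f : β → ℝ≥0∞) :
    expect (p.bind q) f = expect p fun a => expect (q a) f := by
  unfold expect
  simp only [PMF.bind_apply, ← ENNReal.tsum_mul_left, ← ENNReal.tsum_mul_right]
  rw [ENNReal.tsum_comm]
  simp only [mul_assoc]

theorem expect_map {α β : Type*} (p : PMF α) (q : α → β) (f : β → ℝ≥0∞) :
    expect (p.map q) f = expect p fun a => f (q a) := by
  rw [← PMF.bind_pure_comp, expect_bind]
  simp [expect_pure]

theorem expect_mono {α : Type*} (p : PMF α) {f g : α → ℝ≥0∞} (h : ∀ a, f a ≤ g a) :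
    expect p f ≤ expect p g :=
  ENNReal.tsum_le_tsum fun a => mul_le_mul_right (h a) _

theorem expect_coin {p : ℝ} (h0 : 0 ≤ p) (h1 : p ≤ 1) (f : Bool → ℝ≥0∞) :
    expect (coin p) f = ENNReal.ofReal p * f true + ENNReal.ofReal (1 - p) * f false := by
  have h : min p.toNNReal 1 = p.toNNReal := min_eq_left (by simpa using h1)
  unfold expect
  rw [tsum_fintype, Fintype.sum_bool]
  simp only [coin, PMF.ofFintype_apply, cond_true, cond_false, h]
  rw [ENNReal.ofReal_sub _ h0]
  simp [ENNReal.ofReal]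

variable {n m : ℕ} {I : Input n m}

open Classical in
/-- The payoff `Φ` of the memory at the end, infinite for a computation that has not halted or has
used more time than `B`. -/
noncomputable def payoff (Φ : Memory → ℝ≥0∞) (B : ℕ) (c : Config) : ℝ≥0∞ :=
  if c.todo = [] ∧ c.time ≤ B then Φ c.mem else ⊤

/-- A halted configuration is fixed by `step`, and any other one already has infinite payoff. -/
theorem expect_step_payoff_le (Φ : Memory → ℝ≥0∞) (B : ℕ) (c : Config) :
    expect (step I c) (payoff Φ B) ≤ payoff Φ B c := by
  obtain ⟨K, s, t⟩ := c
  cases K with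
  | nil => rw [step, expect_pure]
  | cons P K => simp [payoff]

theorem expect_run_succ_le (Φ : Memory → ℝ≥0∞) (B N : ℕ) (c : Config) :
    expect (run I (N + 1) c) (payoff Φ B) ≤ expect (run I N c) (payoff Φ B) := by
  induction N generalizing c with
  | zero =>
    have : run I 1 c = (step I c).bind (run I 0) := rfl
    rw [this, expect_bind]
    simp only [run, expect_pure]
    exact expect_step_payoff_le Φ B c
  | succ N ih =>
    have h1 : run I (N + 1 + 1) c = (step I c).bind (run I (N + 1)) := rfl
    have h2 : run I (N + 1) c = (step I c).bind (run I N) := rfl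
    rw [h1, h2, expect_bind, expect_bind]
    exact expect_mono _ ih

/-- Allows the two branches of a coin toss, which may need different numbers of steps, to be run for
a common number. -/
theorem expect_run_anti (Φ : Memory → ℝ≥0∞) (B : ℕ) (c : Config) :
    Antitone fun N => expect (run I N c) (payoff Φ B) :=
  antitone_nat_of_succ_le fun N => expect_run_succ_le Φ B N c

/-! ## A program logic -/

/-- Started with the commands `K` and the memory `s`, the machine always halts within time `τ`, and
the expectation of `Φ` of the final memory is at most `v` (provided that `v` is finite). -/
def Bounded (I : Input n m) (Φ : Memory → ℝ≥0∞) (K : List Prog) (s : Memory) (τ : ℕ)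
    (v : ℝ≥0∞) : Prop :=
  ∃ N, ∀ t, expect (run I N ⟨K, s, t⟩) (payoff Φ (t + τ)) ≤ v

namespace Bounded

variable {Φ : Memory → ℝ≥0∞} {K : List Prog} {s : Memory} {τ : ℕ} {v : ℝ≥0∞}

theorem nil (h : Φ s ≤ v) : Bounded I Φ [] s τ v :=
  ⟨0, fun t => by simpa [run, expect_pure, payoff] using h⟩

theorem mono {τ' : ℕ} {v' : ℝ≥0∞} (h : Bounded I Φ K s τ v) (hτ : τ ≤ τ') (hv : v ≤ v') :
    Bounded I Φ K s τ' v' := by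
  obtain ⟨N, hN⟩ := h
  refine ⟨N, fun t => le_trans (expect_mono _ fun c => ?_) ((hN t).trans hv)⟩
  unfold payoff
  split_ifs with h1 h2 h2
  · exact le_rfl
  · exact le_top
  · exact absurd ⟨h2.1, h2.2.trans (by omega)⟩ h1
  · exact le_rfl

theorem of_step {P : Prog} {K' : List Prog} {s' : Memory} {d : ℕ}
    (hs : ∀ t, step I ⟨P :: K, s, t⟩ = PMF.pure ⟨K', s', t + d⟩)
    (h : Bounded I Φ K' s' τ v) : Bounded I Φ (P :: K) s (d + τ) v := by
  obtain ⟨N, hN⟩ := h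
  refine ⟨N + 1, fun t => ?_⟩
  rw [run, hs, PMF.pure_bind, ← add_assoc]
  exact hN _

theorem toss {x : ℕ} {p : RealExpr} {v₁ v₀ : ℝ≥0∞} (h0 : 0 ≤ p.eval I s) (h1 : p.eval I s ≤ 1)
    (ht : Bounded I Φ K (s.setNat x 1) τ v₁) (hf : Bounded I Φ K (s.setNat x 0) τ v₀) :
    Bounded I Φ (.toss x p :: K) s (p.cost + 1 + τ)
      (ENNReal.ofReal (p.eval I s) * v₁ + ENNReal.ofReal (1 - p.eval I s) * v₀) := by
  obtain ⟨N₁, hN₁⟩ := ht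
  obtain ⟨N₀, hN₀⟩ := hf
  refine ⟨max N₁ N₀ + 1, fun t => ?_⟩
  rw [run, step, expect_bind, expect_map, expect_coin h0 h1, ← add_assoc, ← add_assoc]
  refine add_le_add (mul_le_mul_right ?_ _) (mul_le_mul_right ?_ _)
  · exact (expect_run_anti Φ _ _ (le_max_left _ _)).trans (hN₁ _)
  · exact (expect_run_anti Φ _ _ (le_max_right _ _)).trans (hN₀ _)

theorem seq {P Q : Prog} (h : Bounded I Φ (P :: Q :: K) s τ v) :
    Bounded I Φ (.seq P Q :: K) s (1 + τ) v :=
  of_step (fun _ => rfl) h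

theorem loop_enter {b : Test} {P : Prog} (hb : b.Holds I s)
    (h : Bounded I Φ (P :: .loop b P :: K) s τ v) :
    Bounded I Φ (.loop b P :: K) s (b.cost + 1 + τ) v :=
  of_step (fun t => by rw [step, if_pos hb, add_assoc]) h

theorem loop_exit {b : Test} {P : Prog} (hb : ¬ b.Holds I s) (h : Bounded I Φ K s τ v) :
    Bounded I Φ (.loop b P :: K) s (b.cost + 1 + τ) v :=
  of_step (fun t => by rw [step, if_neg hb, add_assoc]) h

/-- What a bound says about the machine. -/
theorem exists_run {P : Prog} (h : Bounded I Φ [P] Memory.init τ v) (hv : v ≠ ⊤) :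
    ∃ N, (∀ c ∈ (run I N P.start).support, c.todo = [] ∧ c.time ≤ τ) ∧
      expect (run I N P.start) (fun c => Φ c.mem) ≤ v := by
  obtain ⟨N, hN⟩ := h
  have hN := hN 0
  rw [zero_add] at hN
  have key : ∀ c ∈ (run I N P.start).support, c.todo = [] ∧ c.time ≤ τ := by
    intro c hc
    by_contra hcon
    -- A reachable configuration has positive mass, so a single late or unfinished one makes the
    -- expectation infinite.
    refine hv (top_le_iff.1 (le_trans ?_ hN))
    refine le_trans ?_ (ENNReal.le_tsum c)
    rw [payoff, if_neg hcon, ENNReal.mul_top]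
    exact (PMF.mem_support_iff _ _).1 hc
  refine ⟨N, key, le_trans (ENNReal.tsum_le_tsum fun c => ?_) hN⟩
  by_cases hc : c ∈ (run I N P.start).support
  · rw [payoff, if_pos (key c hc)]; exact le_rfl
  · have hc : run I N P.start c = 0 := by
      simpa [PMF.mem_support_iff] using hc
    change run I N P.start c * _ ≤ _
    rw [hc]; simp

end Bounded

/-- The program `P`, which tosses no coins when started with the memory `s`, halts within time `τ`
in a memory that satisfies `Post`. -/
def Achieves (I : Input n m) (P : Prog) (τ : ℕ) (s : Memory) (Post : Memory → Prop) : Prop :=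
  ∀ (Φ : Memory → ℝ≥0∞) (K : List Prog) (τ' : ℕ) (v : ℝ≥0∞),
    (∀ s', Post s' → Bounded I Φ K s' τ' v) → Bounded I Φ (P :: K) s (τ + τ') v

namespace Achieves

variable {P Q : Prog} {τ τ₁ τ₂ : ℕ} {s : Memory} {A B : Memory → Prop}

theorem mono (h : Achieves I P τ₁ s A) (hτ : τ₁ ≤ τ) (hAB : ∀ s', A s' → B s') :
    Achieves I P τ s B := fun Φ K τ' v hK =>
  (h Φ K τ' v fun s' hs' => hK s' (hAB s' hs')).mono (by omega) le_rfl

theorem seq (hP : Achieves I P τ₁ s A) (hQ : ∀ s', A s' → Achieves I Q τ₂ s' B) :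
    Achieves I (.seq P Q) (1 + (τ₁ + τ₂)) s B := fun Φ K τ' v hK => by
  rw [add_assoc, add_assoc]
  exact Bounded.seq (hP Φ _ _ v fun s' hs' => hQ s' hs' Φ K τ' v hK)

/-- A loop with an invariant that is indexed by a bound for the number of the remaining rounds. -/
theorem loop {b : Test} {J : ℕ → Memory → Prop} {c : ℕ}
    (hbody : ∀ d s, J d s → b.Holds I s → 0 < d ∧ Achieves I P c s (J (d - 1))) :
    ∀ d s, J d s → Achieves I (.loop b P) (d * (c + b.cost + 1) + (b.cost + 1)) s
      (fun s' => (∃ d', J d' s') ∧ ¬ b.Holds I s') := by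
  intro d
  induction d with
  | zero =>
    intro s hs Φ K τ' v hK
    by_cases hb : b.Holds I s
    · exact absurd (hbody 0 s hs hb).1 (lt_irrefl 0)
    · rw [zero_mul, zero_add]
      exact Bounded.loop_exit hb (hK s ⟨⟨0, hs⟩, hb⟩)
  | succ d ih =>
    intro s hs Φ K τ' v hK
    by_cases hb : b.Holds I s
    · have h := (hbody _ s hs hb).2 Φ (.loop b P :: K) _ v
        fun s' hs' => ih s' hs' Φ K τ' v hK
      refine (Bounded.loop_enter hb h).mono ?_ le_rfl
      ring_nf
      omega
    · exact (Bounded.loop_exit hb (hK s ⟨⟨_, hs⟩, hb⟩)).mono (by nlinarith) le_rfl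

end Achieves

/-! ### Straight-line programs -/

/-- Programs without loops and coin tosses. -/
def Prog.Straight : Prog → Prop
  | .toss _ _ => False
  | .loop _ _ => False
  | .seq P Q => P.Straight ∧ Q.Straight
  | .ite _ P Q => P.Straight ∧ Q.Straight
  | _ => True

open Classical in
/-- The effect of a straight-line program. -/
noncomputable def Prog.exec (I : Input n m) : Prog → Memory → Memory
  | .setNat x e, s => s.setNat x (e.eval I s)
  | .setReal x e, s => s.setReal x (e.eval I s)
  | .storeNat a i e, s => s.storeNat a (i.eval I s) (e.eval I s)
  | .storeReal a i e, s => s.storeReal a (i.eval I s) (e.eval I s)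
  | .toss _ _, s => s
  | .loop _ _, s => s
  | .seq P Q, s => Q.exec I (P.exec I s)
  | .ite b P Q, s => if b.Holds I s then P.exec I s else Q.exec I s

/-- A bound for the time that a straight-line program takes. -/
def Prog.time : Prog → ℕ
  | .setNat _ e => e.cost + 1
  | .setReal _ e => e.cost + 1
  | .storeNat _ i e => i.cost + e.cost + 1
  | .storeReal _ i e => i.cost + e.cost + 1
  | .toss _ _ => 0
  | .loop _ _ => 0
  | .seq P Q => 1 + (P.time + Q.time)
  | .ite b P Q => b.cost + 1 + (P.time + Q.time)

theorem Achieves.straight {P : Prog} {s : Memory} (hP : P.Straight) :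
    Achieves I P P.time s (fun s' => s' = P.exec I s) := by
  induction P generalizing s with
  | toss _ _ => exact hP.elim
  | loop _ _ _ => exact hP.elim
  | seq P Q ihP ihQ =>
    refine Achieves.seq (ihP hP.1) fun s' hs' => ?_
    subst hs'
    exact ihQ hP.2
  | ite b P Q ihP ihQ =>
    intro Φ K τ' v hK
    by_cases hb : b.Holds I s
    · refine (Bounded.of_step (K' := P :: K) (s' := s) (d := b.cost + 1)
        (fun t => by rw [step, if_pos hb, add_assoc])
        (ihP hP.1 Φ K τ' v fun s' hs' => hK s' ?_)).mono (by simp only [Prog.time]; omega) le_rfl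
      rw [hs', Prog.exec, if_pos hb]
    · refine (Bounded.of_step (K' := Q :: K) (s' := s) (d := b.cost + 1)
        (fun t => by rw [step, if_neg hb, add_assoc])
        (ihQ hP.2 Φ K τ' v fun s' hs' => hK s' ?_)).mono (by simp only [Prog.time]; omega) le_rfl
      rw [hs', Prog.exec, if_neg hb]
  | setNat x e =>
    exact fun Φ K τ' v hK => Bounded.of_step (fun t => by simp only [step, Prog.time, Prog.exec, add_assoc]) (hK _ rfl)
  | setReal x e =>
    exact fun Φ K τ' v hK => Bounded.of_step (fun t => by simp only [step, Prog.time, Prog.exec, add_assoc]) (hK _ rfl)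
  | storeNat a i e =>
    exact fun Φ K τ' v hK => Bounded.of_step
      (fun t => by simp only [step, Prog.time, Prog.exec, add_assoc]) (hK _ rfl)
  | storeReal a i e =>
    exact fun Φ K τ' v hK => Bounded.of_step
      (fun t => by simp only [step, Prog.time, Prog.exec, add_assoc]) (hK _ rfl)

/-! ## The method: one round, and its potential -/

/-! ### Elementary inequalities behind the two updates -/

section Inequalities

/-- Controls the quotient of two growth factors to second order for all real `a`, `b`. This is the
reason for the factor `1 + z + z²` instead of `exp z`: the estimates can be as large as `η √n / 2`,
and no truncation is needed. -/
theorem growth_le (a b : ℝ) :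
    1 + a + a ^ 2 ≤ (1 + b + b ^ 2) * (1 + a - b + 4 * (a ^ 2 + b ^ 2)) := by
  nlinarith [sq_nonneg (a - b), sq_nonneg (a + b), sq_nonneg (b + 1), sq_nonneg (a * b),
    sq_nonneg (a * (b + 1)), sq_nonneg (a * (2 * b + 1)), sq_nonneg (b * (2 * b + 1)),
    sq_nonneg (b ^ 2), sq_nonneg (b ^ 2 + b), sq_nonneg (a * b + b), sq_nonneg (a * b + b ^ 2)]

theorem growth_pos (a : ℝ) : 0 < 1 + a + a ^ 2 := by nlinarith [sq_nonneg (2 * a + 1)]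

theorem exp_le_quadratic {y : ℝ} (h : |y| ≤ 1) : Real.exp y ≤ 1 + y + y ^ 2 := by
  have := Real.abs_exp_sub_one_sub_id_le h
  rw [abs_le] at this
  linarith

end Inequalities

/-- The projection of a number to `[-r, r]`. -/
noncomputable def clip (r y : ℝ) : ℝ := if y < -r then -r else if r < y then r else y

theorem clip_mem {r : ℝ} (hr : 0 ≤ r) (y : ℝ) : clip r y ∈ Set.Icc (-r) r := by
  unfold clip
  split_ifs <;> constructor <;> linarith

theorem clip_sub_sq_le {r c : ℝ} (hc : c ∈ Set.Icc (-r) r) (y : ℝ) :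
    (clip r y - c) ^ 2 ≤ (y - c) ^ 2 := by
  obtain ⟨h1, h2⟩ := hc
  unfold clip
  split_ifs <;> nlinarith

/-- The radius of the cube. -/
noncomputable def radius (n : ℕ) : ℝ := 1 / √(n : ℝ)

theorem radius_nonneg (n : ℕ) : 0 ≤ radius n := by unfold radius; positivity

/-- A projected gradient step. -/
noncomputable def Input.nextPoint (I : Input n m) (η : ℝ) (x : EuclideanSpace ℝ (Fin n))
    (j : Fin m) : EuclideanSpace ℝ (Fin n) :=
  WithLp.toLp 2 fun i => clip (radius n) (x i - η * (I.v' i + I.v j i))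

/-- A multiplicative weights step with the one-coordinate estimate of the inner products. -/
noncomputable def Input.nextWeight (I : Input n m) (η : ℝ) (x : EuclideanSpace ℝ (Fin n))
    (w : Fin m → ℝ) (i : Fin n) (j : Fin m) : ℝ :=
  w j * (1 + η * n * I.v j i * x i + (η * n * I.v j i * x i) ^ 2)

/-- The running average of the points. -/
noncomputable def nextAverage (t : ℕ) (A x : EuclideanSpace ℝ (Fin n)) :
    EuclideanSpace ℝ (Fin n) :=
  WithLp.toLp 2 fun i => A i + (x i - A i) / (t + 1)

theorem Input.nextPoint_mem (I : Input n m) (η : ℝ) (x : EuclideanSpace ℝ (Fin n)) (j : Fin m) :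
    I.nextPoint η x j ∈ cube n := fun _ => clip_mem (radius_nonneg n) _

theorem Input.nextWeight_pos (I : Input n m) (η : ℝ) (x : EuclideanSpace ℝ (Fin n))
    {w : Fin m → ℝ} (hw : ∀ j, 0 < w j) (i : Fin n) (j : Fin m) : 0 < I.nextWeight η x w i j :=
  mul_pos (hw j) (growth_pos _)

theorem nextAverage_mem (t : ℕ) {A x : EuclideanSpace ℝ (Fin n)} (hA : A ∈ cube n)
    (hx : x ∈ cube n) : nextAverage t A x ∈ cube n := by
  intro i
  obtain ⟨h1, h2⟩ := hA i
  obtain ⟨h3, h4⟩ := hx i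
  have ht : (0 : ℝ) < t + 1 := by positivity
  have : nextAverage t A x i = (t * A i + x i) / (t + 1) := by
    simp only [nextAverage]; field_simp; ring
  rw [this]
  have ht' : (0 : ℝ) ≤ t := by positivity
  constructor
  · rw [le_div_iff₀ ht]; nlinarith
  · rw [div_le_iff₀ ht]; nlinarith

theorem inner_nextAverage (t : ℕ) (A x c : EuclideanSpace ℝ (Fin n)) :
    ((t : ℝ) + 1) * inner ℝ c (nextAverage t A x) = t * inner ℝ c A + inner ℝ c x := by
  have ht : (t : ℝ) + 1 ≠ 0 := by positivity
  have : nextAverage t A x = A + ((t : ℝ) + 1)⁻¹ • (x - A) := by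
    ext i; simp [nextAverage]; field_simp
  rw [this, inner_add_right, inner_smul_right, inner_sub_right]
  field_simp
  ring

/-! ### Geometry of the scaled cube -/

theorem zero_mem_cube : (0 : EuclideanSpace ℝ (Fin n)) ∈ cube n := fun _ => by
  have := radius_nonneg n
  simp only [radius] at this
  simp only [PiLp.zero_apply, Set.mem_Icc]
  constructor <;> linarith

/-- This cancels the factor `n` in the second moment of the one-coordinate estimate, so that uniform
sampling of coordinates is good enough. -/
theorem sq_le_of_mem_cube {x : EuclideanSpace ℝ (Fin n)} (hx : x ∈ cube n) (i : Fin n) :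
    n * x i ^ 2 ≤ 1 := by
  have hn : (0 : ℝ) < n := by exact_mod_cast i.pos
  have h : x i ^ 2 ≤ (1 / √(n : ℝ)) ^ 2 := sq_le_sq' (hx i).1 (hx i).2
  rw [div_pow, Real.sq_sqrt hn.le, one_pow, le_div_iff₀ hn] at h
  linarith

theorem norm_le_one_of_mem_cube {x : EuclideanSpace ℝ (Fin n)} (hx : x ∈ cube n) : ‖x‖ ≤ 1 := by
  have h : ‖x‖ ^ 2 ≤ 1 := by
    rcases Nat.eq_zero_or_pos n with rfl | hn
    · simp [EuclideanSpace.real_norm_sq_eq]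
    rw [EuclideanSpace.real_norm_sq_eq]
    have hn : (0 : ℝ) < n := by exact_mod_cast hn
    calc ∑ i, x i ^ 2 ≤ ∑ _i : Fin n, 1 / (n : ℝ) :=
          Finset.sum_le_sum fun i _ => by
            rw [le_div_iff₀ hn]; linarith [sq_le_of_mem_cube hx i]
      _ = 1 := by simp [hn.ne']
  nlinarith [norm_nonneg x]

theorem inner_eq_sum (x y : EuclideanSpace ℝ (Fin n)) : inner ℝ x y = ∑ i, x i * y i := by
  rw [PiLp.inner_apply]
  exact Finset.sum_congr rfl fun i _ => by simp [mul_comm]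

/-- The exponent in the potential. -/
noncomputable def Input.exponent (I : Input n m) (η OPT : ℝ) (xs : EuclideanSpace ℝ (Fin n))
    (t : ℕ) (A x : EuclideanSpace ℝ (Fin n)) (j : Fin m) : ℝ :=
  η * (t * inner ℝ (I.v' + I.v j) A) - η * t * OPT - (1 - ‖x - xs‖ ^ 2) / 2 - η ^ 2 * t / 2

/-- The potential. -/
noncomputable def Input.potential (I : Input n m) (η OPT : ℝ) (xs : EuclideanSpace ℝ (Fin n))
    (t : ℕ) (A x : EuclideanSpace ℝ (Fin n)) (w : Fin m → ℝ) : ℝ :=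
  ∑ j, Real.exp (I.exponent η OPT xs t A x j) * ((∑ l, w l) / w j)

/-! ### Drift of the potential over one round -/

section Round

variable {I : Input n m} {η OPT : ℝ} {xs x : EuclideanSpace ℝ (Fin n)} {w : Fin m → ℝ}

theorem norm_nextPoint_sub_sq_le (hxs : xs ∈ cube n) (j : Fin m) :
    ‖I.nextPoint η x j - xs‖ ^ 2 ≤ ‖x - η • (I.v' + I.v j) - xs‖ ^ 2 := by
  rw [EuclideanSpace.real_norm_sq_eq, EuclideanSpace.real_norm_sq_eq]
  exact Finset.sum_le_sum fun i _ => clip_sub_sq_le (hxs i) _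

/-- The regret inequality of gradient descent. Projection does not increase the distance to `xs`,
and expanding the square produces `-η ⟨v' + v_l, x - xs⟩`, where the `xs` part is at most `η OPT`.
The term `⟨v', x⟩` enters once through the average and once, with the opposite sign, through the
step, and so disappears. -/
theorem exponent_next_le (hη : 0 ≤ η) (hxs : xs ∈ cube n)
    (hOPT : ∀ j, inner ℝ (I.v' + I.v j) xs ≤ OPT) (hv' : ‖I.v'‖ ≤ 1 / 2)
    (hv : ∀ j, ‖I.v j‖ ≤ 1 / 2) (t : ℕ) (A : EuclideanSpace ℝ (Fin n)) (j l : Fin m) :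
    I.exponent η OPT xs (t + 1) (nextAverage t A x) (I.nextPoint η x l) j ≤
      I.exponent η OPT xs t A x j + η * inner ℝ (I.v j) x - η * inner ℝ (I.v l) x := by
  have h1 := norm_nextPoint_sub_sq_le (I := I) (η := η) (x := x) hxs l
  have h2 : ‖x - η • (I.v' + I.v l) - xs‖ ^ 2 = ‖x - xs‖ ^ 2
      - 2 * (η * inner ℝ (I.v' + I.v l) (x - xs)) + η ^ 2 * ‖I.v' + I.v l‖ ^ 2 := by
    rw [sub_right_comm, norm_sub_sq_real, inner_smul_right, norm_smul, mul_pow,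
      real_inner_comm, Real.norm_eq_abs, sq_abs]
  -- The resulting error of at most `η² / 2` is paid for by the last term of the exponent.
  have h3 : ‖I.v' + I.v l‖ ^ 2 ≤ 1 := by
    have := (norm_add_le (I.v') (I.v l)).trans (add_le_add hv' (hv l))
    nlinarith [norm_nonneg (I.v' + I.v l)]
  have h4 := inner_nextAverage t A x (I.v' + I.v j)
  have h5 := mul_le_mul_of_nonneg_left (hOPT l) hη
  have h6 := mul_le_mul_of_nonneg_left h3 (sq_nonneg η)
  rw [inner_sub_right] at h2
  have h7 : inner ℝ (I.v' + I.v j) x = inner ℝ I.v' x + inner ℝ (I.v j) x := inner_add_left _ _ _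
  have h8 : inner ℝ (I.v' + I.v l) x = inner ℝ I.v' x + inner ℝ (I.v l) x := inner_add_left _ _ _
  unfold Input.exponent
  push_cast
  rw [h4]
  rw [h8] at h2
  rw [h7]
  nlinarith

theorem abs_inner_le (hx : x ∈ cube n) (hv : ∀ j, ‖I.v j‖ ≤ 1 / 2) (j : Fin m) :
    |inner ℝ (I.v j) x| ≤ 1 / 2 := by
  refine (abs_real_inner_le_norm _ _).trans ?_
  have := norm_le_one_of_mem_cube hx
  nlinarith [hv j, norm_nonneg (I.v j), norm_nonneg x]

/-- The mean of the estimates. -/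
theorem mean_estimate (j : Fin m) :
    ∑ i : Fin n, 1 / (n : ℝ) * (η * n * I.v j i * x i) = η * inner ℝ (I.v j) x := by
  rw [inner_eq_sum, Finset.mul_sum]
  refine Finset.sum_congr rfl fun i _ => ?_
  have hn : (n : ℝ) ≠ 0 := by exact_mod_cast i.pos.ne'
  field_simp

/-- The second moment of the estimates. -/
theorem mean_estimate_sq_le (hx : x ∈ cube n) (hv : ∀ j, ‖I.v j‖ ≤ 1 / 2) (j : Fin m) :
    ∑ i : Fin n, 1 / (n : ℝ) * (η * n * I.v j i * x i) ^ 2 ≤ η ^ 2 / 4 := by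
  have h : ‖I.v j‖ ^ 2 ≤ 1 / 4 := by nlinarith [hv j, norm_nonneg (I.v j)]
  rw [EuclideanSpace.real_norm_sq_eq] at h
  calc ∑ i : Fin n, 1 / (n : ℝ) * (η * n * I.v j i * x i) ^ 2
      ≤ ∑ i : Fin n, η ^ 2 * (I.v j i) ^ 2 := Finset.sum_le_sum fun i _ => by
        have hn : (n : ℝ) ≠ 0 := by exact_mod_cast i.pos.ne'
        have h1 : 1 / (n : ℝ) * (η * n * I.v j i * x i) ^ 2
            = η ^ 2 * (I.v j i) ^ 2 * (n * x i ^ 2) := by field_simp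
        rw [h1]
        exact mul_le_of_le_one_right (by positivity) (sq_le_of_mem_cube hx i)
    _ ≤ η ^ 2 / 4 := by rw [← Finset.mul_sum]; nlinarith [sq_nonneg η]

/-- Written as `∑_l w_l / w_j` times a quotient of growth factors, the new ratio is linearized by
`growth_le`; then only the first two moments of the estimates matter. -/
theorem mean_ratio_le (hn : 0 < n) (hx : x ∈ cube n) (hv : ∀ j, ‖I.v j‖ ≤ 1 / 2)
    (hw : ∀ j, 0 < w j) (j : Fin m) :
    ∑ i : Fin n, 1 / (n : ℝ) * ((∑ l, I.nextWeight η x w i l) / I.nextWeight η x w i j) ≤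
      (∑ l, w l) / w j * (1 + (∑ l, w l / (∑ l, w l) * (η * inner ℝ (I.v l) x))
        - η * inner ℝ (I.v j) x + 2 * η ^ 2) := by
  have hn' : (0 : ℝ) < n := by exact_mod_cast hn
  have hW : 0 < ∑ l, w l := Finset.sum_pos (fun l _ => hw l) ⟨j, Finset.mem_univ j⟩
  set z : Fin n → Fin m → ℝ := fun i l => η * n * I.v l i * x i with hz
  have h1 : ∀ i, (∑ l, I.nextWeight η x w i l) / I.nextWeight η x w i j ≤
      ∑ l, w l / w j * (1 + z i l - z i j + 4 * (z i l ^ 2 + z i j ^ 2)) := by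
    intro i
    rw [Finset.sum_div]
    refine Finset.sum_le_sum fun l _ => ?_
    rw [div_le_iff₀ (I.nextWeight_pos η x hw i j)]
    have h2 := mul_le_mul_of_nonneg_left (growth_le (z i l) (z i j)) (hw l).le
    have h3 := (hw j).ne'
    refine h2.trans (le_of_eq ?_)
    simp only [Input.nextWeight, hz]
    field_simp
  -- `2 η²` is `4 (η² / 4 + η² / 4)`, from the second moments of the two estimates.
  have h4 : ∀ l, ∑ i : Fin n, 1 / (n : ℝ) * (1 + z i l - z i j + 4 * (z i l ^ 2 + z i j ^ 2)) ≤
      1 + η * inner ℝ (I.v l) x - η * inner ℝ (I.v j) x + 2 * η ^ 2 := by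
    intro l
    have h5 : ∑ i : Fin n, 1 / (n : ℝ) * (1 + z i l - z i j + 4 * (z i l ^ 2 + z i j ^ 2)) =
        1 + (∑ i : Fin n, 1 / (n : ℝ) * z i l) - (∑ i : Fin n, 1 / (n : ℝ) * z i j)
          + 4 * ((∑ i : Fin n, 1 / (n : ℝ) * z i l ^ 2)
            + ∑ i : Fin n, 1 / (n : ℝ) * z i j ^ 2) := by
      have h6 : ∑ _i : Fin n, 1 / (n : ℝ) = 1 := by simp [hn'.ne']
      have h7 : ∀ i, 1 / (n : ℝ) * (1 + z i l - z i j + 4 * (z i l ^ 2 + z i j ^ 2)) =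
          1 / (n : ℝ) + 1 / (n : ℝ) * z i l - 1 / (n : ℝ) * z i j
            + 4 * (1 / (n : ℝ) * z i l ^ 2 + 1 / (n : ℝ) * z i j ^ 2) := fun i => by ring
      simp only [h7, Finset.sum_add_distrib, Finset.sum_sub_distrib, ← Finset.mul_sum, h6]
    rw [h5, mean_estimate, mean_estimate]
    have := mean_estimate_sq_le (η := η) hx hv l
    have := mean_estimate_sq_le (η := η) hx hv j
    linarith
  calc ∑ i : Fin n, 1 / (n : ℝ) * ((∑ l, I.nextWeight η x w i l) / I.nextWeight η x w i j)
      ≤ ∑ i : Fin n, 1 / (n : ℝ) *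
          ∑ l, w l / w j * (1 + z i l - z i j + 4 * (z i l ^ 2 + z i j ^ 2)) :=
        Finset.sum_le_sum fun i _ => mul_le_mul_of_nonneg_left (h1 i) (by positivity)
    _ = ∑ l, w l / w j *
          ∑ i : Fin n, 1 / (n : ℝ) * (1 + z i l - z i j + 4 * (z i l ^ 2 + z i j ^ 2)) := by
        simp only [Finset.mul_sum]
        rw [Finset.sum_comm]
        exact Finset.sum_congr rfl fun l _ => Finset.sum_congr rfl fun i _ => by ring
    _ ≤ ∑ l, w l / w j *
          (1 + η * inner ℝ (I.v l) x - η * inner ℝ (I.v j) x + 2 * η ^ 2) :=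
        Finset.sum_le_sum fun l _ =>
          mul_le_mul_of_nonneg_left (h4 l) (div_pos (hw l) (hw j)).le
    _ = _ := by
        have h7 : ∑ l, w l / w j * (η * inner ℝ (I.v l) x) =
            (∑ l, w l) / w j * ∑ l, w l / (∑ l, w l) * (η * inner ℝ (I.v l) x) := by
          rw [Finset.mul_sum]
          refine Finset.sum_congr rfl fun l _ => ?_
          have := hW.ne'
          have := (hw j).ne'
          field_simp
        have h8 : ∀ l, w l / w j *
            (1 + η * inner ℝ (I.v l) x - η * inner ℝ (I.v j) x + 2 * η ^ 2) =
            w l * ((1 - η * inner ℝ (I.v j) x + 2 * η ^ 2) / w j)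
              + w l / w j * (η * inner ℝ (I.v l) x) := fun l => by ring
        rw [Finset.sum_congr rfl fun l _ => h8 l, Finset.sum_add_distrib, h7, ← Finset.sum_mul]
        ring

theorem mean_exp_le (hη : 0 ≤ η) (hη1 : η ≤ 1) (hx : x ∈ cube n) (hv : ∀ j, ‖I.v j‖ ≤ 1 / 2)
    (hw : ∀ j, 0 < w j) (hm : 0 < m) :
    ∑ l, w l / (∑ l, w l) * Real.exp (-(η * inner ℝ (I.v l) x)) ≤
      1 - (∑ l, w l / (∑ l, w l) * (η * inner ℝ (I.v l) x)) + η ^ 2 / 4 := by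
  have hW : 0 < ∑ l, w l := Finset.sum_pos (fun l _ => hw l) ⟨⟨0, hm⟩, Finset.mem_univ _⟩
  have h1 : ∑ l, w l / (∑ l, w l) = 1 := by rw [← Finset.sum_div, div_self hW.ne']
  calc ∑ l, w l / (∑ l, w l) * Real.exp (-(η * inner ℝ (I.v l) x))
      ≤ ∑ l, (w l / (∑ l, w l) - w l / (∑ l, w l) * (η * inner ℝ (I.v l) x)
          + w l / (∑ l, w l) * (η ^ 2 / 4)) := Finset.sum_le_sum fun l _ => by
        have h2 := abs_inner_le hx hv l
        have h3 : |-(η * inner ℝ (I.v l) x)| ≤ 1 := by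
          rw [abs_neg, abs_mul, abs_of_nonneg hη]
          nlinarith [abs_nonneg (inner ℝ (I.v l) x)]
        have h4 : inner ℝ (I.v l) x ^ 2 ≤ 1 / 4 := by
          rw [← sq_abs]; nlinarith [abs_nonneg (inner ℝ (I.v l) x)]
        have h5 := exp_le_quadratic h3
        have h6 : Real.exp (-(η * inner ℝ (I.v l) x)) ≤
            1 - η * inner ℝ (I.v l) x + η ^ 2 / 4 := by
          nlinarith [mul_le_mul_of_nonneg_left h4 (sq_nonneg η)]
        have := mul_le_mul_of_nonneg_left h6 (div_pos (hw l) hW).le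
        linarith
    _ = _ := by
        rw [Finset.sum_add_distrib, Finset.sum_sub_distrib, ← Finset.sum_mul, h1, one_mul]

/-- The potential is almost a supermartingale. -/
theorem mean_potential_le (hn : 0 < n) (hm : 0 < m) (hη : 0 ≤ η) (hη1 : η ≤ 1)
    (hxs : xs ∈ cube n) (hOPT : ∀ j, inner ℝ (I.v' + I.v j) xs ≤ OPT) (hv' : ‖I.v'‖ ≤ 1 / 2)
    (hv : ∀ j, ‖I.v j‖ ≤ 1 / 2) (hx : x ∈ cube n) (hw : ∀ j, 0 < w j)
    (t : ℕ) (A : EuclideanSpace ℝ (Fin n)) :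
    ∑ l, w l / (∑ l, w l) * ∑ i : Fin n, 1 / (n : ℝ) *
        I.potential η OPT xs (t + 1) (nextAverage t A x) (I.nextPoint η x l)
          (I.nextWeight η x w i) ≤
      Real.exp (3 * η ^ 2) * I.potential η OPT xs t A x w := by
  have hW : 0 < ∑ l, w l := Finset.sum_pos (fun l _ => hw l) ⟨⟨0, hm⟩, Finset.mem_univ _⟩
  set E : Fin m → ℝ := I.exponent η OPT xs t A x with hE
  set a : Fin m → ℝ := fun l => inner ℝ (I.v l) x with ha
  set q : Fin m → ℝ := fun l => w l / ∑ l, w l with hq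
  have hq0 : ∀ l, 0 ≤ q l := fun l => (div_pos (hw l) hW).le
  set R : Fin n → Fin m → ℝ :=
    fun i j => (∑ l, I.nextWeight η x w i l) / I.nextWeight η x w i j with hR
  have hR0 : ∀ i j, 0 ≤ R i j := fun i j =>
    div_nonneg (Finset.sum_nonneg fun l _ => (I.nextWeight_pos η x hw i l).le)
      (I.nextWeight_pos η x hw i j).le
  -- Each summand is split into a factor that depends on `l` and not on `i`, and a factor that
  -- depends on `i` and not on `l`.
  have h1 : ∀ l i, I.potential η OPT xs (t + 1) (nextAverage t A x) (I.nextPoint η x l)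
      (I.nextWeight η x w i) ≤
      ∑ j, Real.exp (E j + η * a j) * Real.exp (-(η * a l)) * R i j := fun l i =>
    Finset.sum_le_sum fun j _ => mul_le_mul_of_nonneg_right (by
      rw [← Real.exp_add]
      exact Real.exp_le_exp.2
        (by linarith [exponent_next_le (x := x) hη hxs hOPT hv' hv t A j l])) (hR0 i j)
  -- By independence the mean is a product of two means. The first is about `exp(-α)` and the second
  -- about `exp(α - η a_j)` times the old ratio, so all first-order terms cancel. What is left is
  -- `exp((1/4 + 2) η²)`.
  have h2 : ∀ j, Real.exp (E j + η * a j) * (∑ l, q l * Real.exp (-(η * a l))) *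
      (∑ i, 1 / (n : ℝ) * R i j) ≤
      Real.exp (3 * η ^ 2) * (Real.exp (E j) * ((∑ l, w l) / w j)) := by
    intro j
    set α := ∑ l, q l * (η * a l) with hα
    have h3 : ∑ l, q l * Real.exp (-(η * a l)) ≤ Real.exp (-α + η ^ 2 / 4) :=
      (mean_exp_le hη hη1 hx hv hw hm).trans
        ((by linarith : _ ≤ (-α + η ^ 2 / 4) + 1).trans (Real.add_one_le_exp _))
    have h4 : ∑ i, 1 / (n : ℝ) * R i j ≤
        (∑ l, w l) / w j * Real.exp (α - η * a j + 2 * η ^ 2) :=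
      (mean_ratio_le hn hx hv hw j).trans (mul_le_mul_of_nonneg_left
        ((by linarith : _ ≤ (α - η * a j + 2 * η ^ 2) + 1).trans (Real.add_one_le_exp _))
        (div_pos hW (hw j)).le)
    have h5 : 0 ≤ ∑ i, 1 / (n : ℝ) * R i j :=
      Finset.sum_nonneg fun i _ => mul_nonneg (by positivity) (hR0 i j)
    have h6 : 0 ≤ (∑ l, w l) / w j := (div_pos hW (hw j)).le
    calc _ ≤ Real.exp (E j + η * a j) * Real.exp (-α + η ^ 2 / 4) *
          ((∑ l, w l) / w j * Real.exp (α - η * a j + 2 * η ^ 2)) := by gcongr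
      _ = Real.exp (9 / 4 * η ^ 2) * (Real.exp (E j) * ((∑ l, w l) / w j)) := by
          have : Real.exp (9 / 4 * η ^ 2) * Real.exp (E j) = Real.exp (E j + η * a j) *
              Real.exp (-α + η ^ 2 / 4) * Real.exp (α - η * a j + 2 * η ^ 2) := by
            rw [← Real.exp_add, ← Real.exp_add, ← Real.exp_add]; ring_nf
          rw [← mul_assoc (Real.exp (9 / 4 * η ^ 2)), this]; ring
      _ ≤ _ := by
          gcongr
          nlinarith [sq_nonneg η]
  calc _ ≤ ∑ l, q l * ∑ i : Fin n, 1 / (n : ℝ) *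
        ∑ j, Real.exp (E j + η * a j) * Real.exp (-(η * a l)) * R i j :=
        Finset.sum_le_sum fun l _ => mul_le_mul_of_nonneg_left
          (Finset.sum_le_sum fun i _ => mul_le_mul_of_nonneg_left (h1 l i) (by positivity))
          (hq0 l)
    _ = ∑ j, Real.exp (E j + η * a j) * (∑ l, q l * Real.exp (-(η * a l))) *
          (∑ i, 1 / (n : ℝ) * R i j) := by
        simp only [Finset.mul_sum, Finset.sum_mul]
        rw [Finset.sum_congr rfl fun l _ => Finset.sum_comm, Finset.sum_comm]
        refine Finset.sum_congr rfl fun j _ => ?_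
        rw [Finset.sum_comm]
        refine Finset.sum_congr rfl fun i _ => Finset.sum_congr rfl fun l _ => ?_
        ring
    _ ≤ ∑ j, Real.exp (3 * η ^ 2) * (Real.exp (E j) * ((∑ l, w l) / w j)) :=
        Finset.sum_le_sum fun j _ => h2 j
    _ = _ := by rw [← Finset.mul_sum]; rfl

/-- The constant `1` in the exponent bounds `‖xs‖²`, so every exponential is at most `1` at the
start. -/
theorem potential_start_le (hxs : xs ∈ cube n) :
    I.potential η OPT xs 0 0 0 (fun _ => 1) ≤ (m : ℝ) ^ 2 := by
  have h := norm_le_one_of_mem_cube hxs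
  have h0 : ∀ j, I.exponent η OPT xs 0 0 0 j ≤ 0 := fun j => by
    simp only [Input.exponent, zero_sub, norm_neg, inner_zero_right, Nat.cast_zero]
    nlinarith [norm_nonneg xs]
  calc I.potential η OPT xs 0 0 0 (fun _ => 1)
      ≤ ∑ _j : Fin m, (m : ℝ) := Finset.sum_le_sum fun j _ => by
        have := Real.exp_le_one_iff.2 (h0 j)
        simp only [Finset.sum_const, Finset.card_univ, Fintype.card_fin, nsmul_eq_mul, mul_one,
          div_one]
        exact mul_le_of_le_one_left (by positivity) this
    _ = (m : ℝ) ^ 2 := by simp [sq]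

theorem potential_nonneg (hw : ∀ j, 0 < w j) (t : ℕ) (A : EuclideanSpace ℝ (Fin n)) :
    0 ≤ I.potential η OPT xs t A x w :=
  Finset.sum_nonneg fun j _ => mul_nonneg (Real.exp_pos _).le
    (div_nonneg (Finset.sum_nonneg fun l _ => (hw l).le) (hw j).le)

/-- A bad average makes the potential large. -/
theorem le_potential_of_bad (hη : 0 ≤ η) (hw : ∀ j, 0 < w j) (t : ℕ)
    {A : EuclideanSpace ℝ (Fin n)} (hm : 0 < m) (hbad : I.eps + OPT < I.objective A) :
    Real.exp (η * t * I.eps - 1 / 2 - η ^ 2 * t / 2) ≤ I.potential η OPT xs t A x w := by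
  have : Nonempty (Fin m) := ⟨⟨0, hm⟩⟩
  obtain ⟨j, hj⟩ := exists_lt_of_lt_ciSup hbad
  refine le_trans ?_ (Finset.single_le_sum (f := fun j =>
    Real.exp (I.exponent η OPT xs t A x j) * ((∑ l, w l) / w j)) (fun j _ =>
    mul_nonneg (Real.exp_pos _).le (div_nonneg (Finset.sum_nonneg fun l _ => (hw l).le)
      (hw j).le)) (Finset.mem_univ j))
  have h1 : 1 ≤ (∑ l, w l) / w j := by
    rw [le_div_iff₀ (hw j), one_mul]
    exact Finset.single_le_sum (fun l _ => (hw l).le) (Finset.mem_univ j)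
  refine le_trans (Real.exp_le_exp.2 ?_) (le_mul_of_one_le_right (Real.exp_pos _).le h1)
  have h2 : η * t * (I.eps + OPT) ≤ η * t * inner ℝ (I.v' + I.v j) A :=
    mul_le_mul_of_nonneg_left hj.le (by positivity)
  unfold Input.exponent
  nlinarith [sq_nonneg ‖x - xs‖]

end Round

/-! ## The minimum exists -/

theorem Input.exists_minimum (I : Input n m) :
    ∃ xs ∈ cube n, IsLeast (I.objective '' cube n) (I.objective xs) := by
  have hc : IsCompact (cube n) := by
    have h1 : IsClosed (cube n) := by
      have : cube n = ⋂ i, {x : EuclideanSpace ℝ (Fin n) |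
          x i ∈ Set.Icc (-(1 / √(n : ℝ))) (1 / √(n : ℝ))} := by ext; simp [cube]
      rw [this]
      exact isClosed_iInter fun i => isClosed_Icc.preimage (by fun_prop)
    refine Metric.isCompact_of_isClosed_isBounded h1 ?_
    exact (Metric.isBounded_closedBall (x := 0) (r := 1)).subset fun x hx => by
      simpa using norm_le_one_of_mem_cube hx
  have hf : Continuous I.objective := by
    rcases isEmpty_or_nonempty (Fin m) with h | h
    · have : I.objective = fun _ => 0 := by ext x; simp [Input.objective]
      rw [this]; exact continuous_const
    · have : I.objective = fun x => Finset.univ.sup' Finset.univ_nonempty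
          fun j => inner ℝ (I.v' + I.v j) x := by
        ext x; rw [Finset.sup'_univ_eq_ciSup]; rfl
      rw [this]
      exact Continuous.finset_sup'_apply _ fun j _ => by fun_prop
  obtain ⟨xs, hxs, hmin⟩ := hc.exists_isMinOn ⟨0, zero_mem_cube⟩ hf.continuousOn
  exact ⟨xs, hxs, ⟨xs, hxs, rfl⟩, by rintro _ ⟨y, hy, rfl⟩; exact hmin hy⟩

theorem Input.inner_le_objective (I : Input n m) (x : EuclideanSpace ℝ (Fin n)) (j : Fin m) :
    inner ℝ (I.v' + I.v j) x ≤ I.objective x :=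
  le_ciSup (f := fun j => inner ℝ (I.v' + I.v j) x) (Set.finite_range _).bddAbove j

/-! ## The program

Natural registers: `0` the binary logarithm, `1` a node of the tree, `2` a coin, `3` a coordinate,
`4` a position in a column, `5` a node of the tree, `6` a coordinate, `7` the number of the round,
`8` a power of two. Real arrays: `0` the average, `1` the point, `2` the nodes of the tree of
partial sums of the weights; the leaves are `m, ..., 2 m - 1`, and the children of `p` are `2 p` and
`2 p + 1`. Natural array `0`: the parents of the nodes. -/

/-- The left child of the node in a register. -/
def left (x : ℕ) : NatExpr := .add (.reg x) (.reg x)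

/-- The right child of the node in a register. -/
def right (x : ℕ) : NatExpr := .add (left x) (.const 1)

/-- The step size. -/
def stepSize : RealExpr := .div .eps (.ofNat (.const 8))

def logTest : Test := .natLt (.reg 8) (.add .dim .num)

def logBody : Prog := .seq (.setNat 8 (left 8)) (.setNat 0 (.add (.reg 0) (.const 1)))

/-- Compute the binary logarithm of `n + m`. -/
def computeLog : Prog := .seq (.setNat 8 (.const 1)) (.loop logTest logBody)

def nodeSum (x : ℕ) : Prog := .storeReal 2 (.reg x) (.add (.arr 2 (left x)) (.arr 2 (right x)))

def aboveRoot (x : ℕ) : Test := .natLt (.const 1) (.reg x)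

/-- Nodes are treated in decreasing order, so children precede their parent. Parents are recorded
because halving an index is not a unit-cost operation. -/
def buildBody : Prog :=
  .seq (.setNat 1 (.sub (.reg 1) (.const 1)))
    (.ite (.natLt (.reg 1) .num)
      (.seq (nodeSum 1) (.seq (.storeNat 0 (left 1) (.reg 1)) (.storeNat 0 (right 1) (.reg 1))))
      (.storeReal 2 (.reg 1) (.ofNat (.const 1))))

/-- Build the tree of the weights `1, ..., 1`. -/
def buildTree : Prog := .seq (.setNat 1 (.add .num .num)) (.loop (aboveRoot 1) buildBody)

def bubbleBody : Prog := .seq (.setNat 5 (.arr 0 (.reg 5))) (nodeSum 5)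

/-- Repair the partial sums above the node in register `5`. -/
def bubble : Prog := .loop (aboveRoot 5) bubbleBody

def estimate : RealExpr :=
  .mul (.mul (.mul stepSize (.ofNat .dim)) (.entry (.colAt (.reg 3) (.reg 4)) (.reg 3)))
    (.arr 1 (.reg 3))

def changeLeaf : Prog :=
  .seq (.setNat 5 (.add .num (.colAt (.reg 3) (.reg 4))))
    (.seq (.setReal 0 estimate)
      (.storeReal 2 (.reg 5) (.mul (.arr 2 (.reg 5))
        (.add (.add (.ofNat (.const 1)) (.reg 0)) (.mul (.reg 0) (.reg 0))))))

def columnTest : Test := .natLt (.reg 4) (.colSize (.reg 3))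

def columnBody : Prog :=
  .seq changeLeaf (.seq bubble (.setNat 4 (.add (.reg 4) (.const 1))))

/-- Update the weights of the vectors in a column. -/
def updateWeights : Prog := .seq (.setNat 4 (.const 0)) (.loop columnTest columnBody)

def radiusExpr : RealExpr := .div (.ofNat (.const 1)) (.sqrt (.ofNat .dim))

def negRadius : RealExpr := .sub (.ofNat (.const 0)) radiusExpr

def pointTest : Test := .natLt (.reg 6) .dim

/-- The average absorbs the old coordinate before the point moves. Register `1` still holds the
sampled leaf `m + j`, which is decoded by subtracting `m`. -/
def pointBody : Prog :=
  .seq (.storeReal 0 (.reg 6) (.add (.arr 0 (.reg 6))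
      (.div (.sub (.arr 1 (.reg 6)) (.arr 0 (.reg 6))) (.add (.ofNat (.reg 7)) (.ofNat (.const 1))))))
    (.seq (.setReal 1 (.sub (.arr 1 (.reg 6))
        (.mul stepSize (.add (.base (.reg 6)) (.entry (.sub (.reg 1) .num) (.reg 6))))))
      (.seq (.ite (.realLt (.reg 1) negRadius) (.storeReal 1 (.reg 6) negRadius)
          (.ite (.realLt radiusExpr (.reg 1)) (.storeReal 1 (.reg 6) radiusExpr)
            (.storeReal 1 (.reg 6) (.reg 1))))
        (.setNat 6 (.add (.reg 6) (.const 1)))))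

/-- Update the average and the point. -/
def updatePoint : Prog := .seq (.setNat 6 (.const 0)) (.loop pointTest pointBody)

def walkBody : Prog :=
  .seq (.toss 2 (.div (.arr 2 (left 1)) (.arr 2 (.reg 1))))
    (.ite (.natLt (.const 0) (.reg 2)) (.setNat 1 (left 1)) (.setNat 1 (right 1)))

def walkTest : Test := .natLt (.reg 1) .num

/-- Walk to a random leaf. -/
def sampleVector : Prog := .seq (.setNat 1 (.const 1)) (.loop walkTest walkBody)

def pickTest : Test := .natLt (.reg 2) (.const 1)

/-- Counting down from `n`, the value `q` is accepted with probability `1 / (q + 1)`; at `0`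
acceptance is certain. -/
def pickBody : Prog :=
  .seq (.setNat 3 (.sub (.reg 3) (.const 1)))
    (.toss 2 (.div (.ofNat (.const 1)) (.ofNat (.add (.reg 3) (.const 1)))))

/-- Choose a random coordinate. -/
def sampleCoordinate : Prog :=
  .seq (.setNat 3 .dim) (.seq (.setNat 2 (.const 0)) (.loop pickTest pickBody))

def round : Prog :=
  .seq sampleVector (.seq sampleCoordinate (.seq updateWeights (.seq updatePoint
    (.setNat 7 (.add (.reg 7) (.const 1))))))

/-- Comparing `t ε²` with `64 L`, where `L` is the binary logarithm rounded up, avoids both a real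
logarithm and the rounding of a real number. -/
def mainTest : Test :=
  .realLt (.mul (.mul (.ofNat (.reg 7)) .eps) .eps) (.mul (.ofNat (.const 64)) (.ofNat (.reg 0)))

/-- The algorithm. -/
def optimize : Prog := .seq computeLog (.seq buildTree (.loop mainTest round))

/-! ## Specification of the deterministic parts -/

theorem Achieves.of_exec {P : Prog} {τ : ℕ} {s : Memory} {Post : Memory → Prop}
    (hP : P.Straight) (hτ : P.time ≤ τ) (h : Post (P.exec I s)) : Achieves I P τ s Post :=
  (Achieves.straight hP).mono hτ fun _ hs' => hs' ▸ h

theorem computeLog_spec :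
    Achieves I computeLog (20 * Nat.clog 2 (n + m) + 20) Memory.init
      (fun s => s.natReg 0 = Nat.clog 2 (n + m) ∧ s.natReg 7 = 0 ∧ s.realArr = fun _ _ => 0) := by
  set L := Nat.clog 2 (n + m) with hL
  have hloop := Achieves.loop (I := I) (b := logTest) (P := logBody) (c := logBody.time)
    (J := fun d s => s.natReg 0 + d = L ∧ s.natReg 8 = 2 ^ s.natReg 0 ∧ s.natReg 7 = 0 ∧
      s.realArr = fun _ _ => 0) (by
    rintro d s ⟨h1, h2, h3, h4⟩ hb
    have hb : s.natReg 8 < n + m := hb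
    rw [h2] at hb
    have hlt : s.natReg 0 < L := (Nat.lt_clog_iff_pow_lt (by norm_num)).2 hb
    refine ⟨by omega, Achieves.of_exec ⟨trivial, trivial⟩ le_rfl ?_⟩
    simp only [logBody, left, Prog.exec, Memory.setNat, NatExpr.eval, Function.update_apply]
    simp [h2, h3, h4, pow_succ, mul_two]
    omega)
  refine Achieves.mono (Achieves.seq (Achieves.of_exec (Post := fun s => s.natReg 0 + L = L ∧
    s.natReg 8 = 2 ^ s.natReg 0 ∧ s.natReg 7 = 0 ∧ s.realArr = fun _ _ => 0)
    trivial le_rfl ?_) fun s hs => hloop L s hs) ?_ ?_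
  · simp [Prog.exec, Memory.setNat, NatExpr.eval, Memory.init]
  · simp only [logBody, logTest, left, Prog.time, NatExpr.cost, Test.cost]
    omega
  · rintro s ⟨⟨d, h1, h2, h3, h4⟩, hb⟩
    refine ⟨?_, h3, h4⟩
    have hb : ¬ s.natReg 8 < n + m := hb
    rw [h2] at hb
    have : L ≤ s.natReg 0 := Nat.clog_le_of_le_pow (by omega)
    omega

/-- The real array `2` holds the tree of partial sums of the weights `w`. -/
structure IsTree (w : Fin m → ℝ) (s : Memory) : Prop where
  leaf : ∀ j : Fin m, s.realArr 2 (m + j) = w j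
  node : ∀ p, 0 < p → p < m → s.realArr 2 p = s.realArr 2 (p + p) + s.realArr 2 (p + p + 1)
  parent : ∀ p, 0 < p → p < m → s.natArr 0 (p + p) = p ∧ s.natArr 0 (p + p + 1) = p

theorem buildTree_spec (hm : 0 < m) (s₀ : Memory) :
    Achieves I buildTree (100 * m + 20) s₀
      (fun s => IsTree (fun _ : Fin m => 1) s ∧ s.natReg 0 = s₀.natReg 0 ∧
        s.natReg 7 = s₀.natReg 7 ∧ ∀ a, a ≠ 2 → s.realArr a = s₀.realArr a) := by
  -- All nodes with index greater than `d` are finished.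
  set J : ℕ → Memory → Prop := fun d s => s.natReg 1 = d + 1 ∧ d + 1 ≤ m + m ∧
    (∀ q, d < q → m ≤ q → q < m + m → s.realArr 2 q = 1) ∧
    (∀ q, d < q → q < m → s.realArr 2 q = s.realArr 2 (q + q) + s.realArr 2 (q + q + 1)) ∧
    (∀ q, d < q → q < m → s.natArr 0 (q + q) = q ∧ s.natArr 0 (q + q + 1) = q) ∧
    s.natReg 0 = s₀.natReg 0 ∧ s.natReg 7 = s₀.natReg 7 ∧
    ∀ a, a ≠ 2 → s.realArr a = s₀.realArr a with hJ
  have hloop := Achieves.loop (I := I) (b := aboveRoot 1) (P := buildBody) (c := buildBody.time)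
    (J := J) (by
    rintro d s ⟨h1, h2, h3, h4, h5, h6, h7, h8⟩ hb
    have hb : 1 < s.natReg 1 := hb
    have hd : 0 < d := by omega
    refine ⟨hd, Achieves.of_exec ⟨trivial, ⟨trivial, trivial, trivial⟩, trivial⟩ le_rfl ?_⟩
    simp only [buildBody, nodeSum, left, right, Prog.exec, NatExpr.eval, RealExpr.eval,
      Test.Holds, Memory.setNat, Function.update_self, h1, Nat.add_sub_cancel]
    have e : ∀ q, d - 1 < q → q = d ∨ d < q := fun q hq => by omega
    split_ifs with hdm
    · refine ⟨?_, by omega, ?_, ?_, ?_, ?_, ?_, ?_⟩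
      · simp [Memory.storeNat, Memory.storeReal]; omega
      · intro q hq hq1 hq2
        have : q ≠ d := by omega
        simpa [Memory.storeNat, Memory.storeReal, this] using h3 q (by omega) hq1 hq2
      · intro q hq hq1
        rcases e q hq with rfl | hq'
        · have e1 : q + q ≠ q := by omega
          have e2 : q + q + 1 ≠ q := by omega
          simp only [Memory.storeNat, Memory.storeReal, Function.update_self,
            Function.update_of_ne e1, Function.update_of_ne e2]
        · have e0 : q ≠ d := by omega
          have e1 : q + q ≠ d := by omega
          have e2 : q + q + 1 ≠ d := by omega
          simpa only [Memory.storeNat, Memory.storeReal, Function.update_self,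
            Function.update_of_ne e0, Function.update_of_ne e1, Function.update_of_ne e2]
            using h4 q hq' hq1
      · intro q hq hq1
        rcases e q hq with rfl | hq'
        · simp [Memory.storeNat, Memory.storeReal]
        · have : q + q ≠ d + d := by omega
          have : q + q ≠ d + d + 1 := by omega
          have : q + q + 1 ≠ d + d := by omega
          have : q + q + 1 ≠ d + d + 1 := by omega
          have := h5 q hq' hq1
          simp only [Memory.storeNat, Memory.storeReal, Function.update_self,
            Function.update_apply, *]
          simp [*]
      · simpa [Memory.storeNat, Memory.storeReal] using h6
      · simpa [Memory.storeNat, Memory.storeReal] using h7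
      · intro a ha
        simpa [Memory.storeNat, Memory.storeReal, ha] using h8 a ha
    · refine ⟨?_, by omega, ?_, ?_, ?_, ?_, ?_, ?_⟩
      · simp [Memory.storeReal]; omega
      · intro q hq hq1 hq2
        rcases e q hq with rfl | hq'
        · simp [Memory.storeReal]
        · have : q ≠ d := by omega
          simpa [Memory.storeReal, this] using h3 q hq' hq1 hq2
      · intro q hq hq1
        omega
      · intro q hq hq1
        omega
      · simpa [Memory.storeReal] using h6
      · simpa [Memory.storeReal] using h7
      · intro a ha
        simpa [Memory.storeReal, ha] using h8 a ha)
  refine Achieves.mono (Achieves.seq (Achieves.of_exec (Post := J (m + m - 1))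
    trivial le_rfl ?_) fun s hs => hloop _ s hs) ?_ ?_
  · simp only [Prog.exec, Memory.setNat, NatExpr.eval, hJ]
    refine ⟨by simp; omega, by omega, fun q h1 h2 h3 => by omega, fun q h1 h2 => by omega,
      fun q h1 h2 => by omega, by simp, by simp, fun a ha => by simp⟩
  · have : buildBody.time = 40 := rfl
    have : (aboveRoot 1).cost = 3 := rfl
    have : (Prog.setNat 1 (.add .num .num)).time = 4 := rfl
    obtain ⟨k, rfl⟩ : ∃ k, m = k + 1 := ⟨m - 1, by omega⟩
    simp only [*]
    omega
  · rintro s ⟨⟨d, h1, h2, h3, h4, h5, h6, h7, h8⟩, hb⟩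
    have hb : ¬ 1 < s.natReg 1 := hb
    have hd : d = 0 := by omega
    subst hd
    exact ⟨⟨fun j => h3 _ (by omega) (by omega) (by omega), h4, h5⟩, h6, h7, h8⟩

/-- The partial sums can be wrong only at the parent of the current node. Recomputing that parent
moves the defect one level up; at the root the exceptional index is `1 / 2 = 0`, which is no node.
The index at least halves each time, hence `L` rounds. -/
theorem bubble_spec (w : Fin m → ℝ) (s₀ : Memory) (L : ℕ) (hL : m ≤ 2 ^ L)
    (hp0 : 0 < s₀.natReg 5) (hp : s₀.natReg 5 < m + m)
    (hleaf : ∀ j : Fin m, s₀.realArr 2 (m + j) = w j)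
    (hnode : ∀ p, 0 < p → p < m → p ≠ s₀.natReg 5 / 2 →
      s₀.realArr 2 p = s₀.realArr 2 (p + p) + s₀.realArr 2 (p + p + 1))
    (hpar : ∀ p, 0 < p → p < m → s₀.natArr 0 (p + p) = p ∧ s₀.natArr 0 (p + p + 1) = p) :
    Achieves I bubble (24 * L + 24) s₀
      (fun s => IsTree w s ∧ (∀ r, r ≠ 5 → s.natReg r = s₀.natReg r) ∧
        ∀ a, a ≠ 2 → s.realArr a = s₀.realArr a) := by
  set J : ℕ → Memory → Prop := fun d s => 0 < s.natReg 5 ∧ s.natReg 5 < m + m ∧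
    s.natReg 5 < 2 ^ (d + 1) ∧
    (∀ j : Fin m, s.realArr 2 (m + j) = w j) ∧
    (∀ p, 0 < p → p < m → p ≠ s.natReg 5 / 2 →
      s.realArr 2 p = s.realArr 2 (p + p) + s.realArr 2 (p + p + 1)) ∧
    (∀ p, 0 < p → p < m → s.natArr 0 (p + p) = p ∧ s.natArr 0 (p + p + 1) = p) ∧
    (∀ r, r ≠ 5 → s.natReg r = s₀.natReg r) ∧
    ∀ a, a ≠ 2 → s.realArr a = s₀.realArr a with hJ
  have hloop := Achieves.loop (I := I) (b := aboveRoot 5) (P := bubbleBody)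
    (c := bubbleBody.time) (J := J) (by
    rintro d s ⟨h0, h1, h2, h3, h4, h5, h6, h7⟩ hb
    have hb : 1 < s.natReg 5 := hb
    have hd : 0 < d := by
      rcases Nat.eq_zero_or_pos d with rfl | h
      · omega
      · exact h
    have hpow : 2 ^ (d + 1) = 2 * 2 ^ (d - 1 + 1) := by
      rw [← pow_succ']; congr 2; omega
    have hq : s.natArr 0 (s.natReg 5) = s.natReg 5 / 2 := by
      have := h5 (s.natReg 5 / 2) (by omega) (by omega)
      rcases Nat.even_or_odd' (s.natReg 5) with ⟨c, hc | hc⟩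
      · rw [show s.natReg 5 / 2 + s.natReg 5 / 2 = s.natReg 5 by omega] at this
        exact this.1
      · rw [show s.natReg 5 / 2 + s.natReg 5 / 2 + 1 = s.natReg 5 by omega] at this
        exact this.2
    refine ⟨hd, Achieves.of_exec ⟨trivial, trivial⟩ le_rfl ?_⟩
    simp only [bubbleBody, nodeSum, left, right, Prog.exec, NatExpr.eval, RealExpr.eval,
      Memory.setNat, Function.update_self, hq]
    set p := s.natReg 5 / 2 with hpdef
    refine ⟨?_, ?_, ?_, ?_, ?_, ?_, ?_, ?_⟩
    · simp [Memory.storeReal]; omega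
    · simp [Memory.storeReal]; omega
    · simp only [Memory.storeReal, Function.update_self]; omega
    · intro j
      have : m + (j : ℕ) ≠ p := by omega
      simpa [Memory.storeReal, this] using h3 j
    · intro q hq0 hqm hne
      simp only [Memory.storeReal, Function.update_self] at hne ⊢
      by_cases hqp : q = p
      · have e1 : p + p ≠ p := by omega
        have e2 : p + p + 1 ≠ p := by omega
        rw [hqp]
        simp only [Function.update_self, Function.update_of_ne e1, Function.update_of_ne e2]
      · have e1 : q + q ≠ p := by omega
        have e2 : q + q + 1 ≠ p := by omega
        simpa [e1, e2, hqp] using h4 q hq0 hqm (by omega)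
    · exact h5
    · intro r hr
      simpa [Memory.storeReal, hr] using h6 r hr
    · intro a ha
      simpa [Memory.storeReal, ha] using h7 a ha)
  refine Achieves.mono (hloop L s₀ ⟨hp0, hp, ?_, hleaf, hnode, hpar, fun _ _ => rfl,
    fun _ _ => rfl⟩) ?_ ?_
  · rw [pow_succ]; omega
  · have : bubbleBody.time = 17 := rfl
    have : (aboveRoot 5).cost = 3 := rfl
    simp only [*]
    omega
  · rintro s ⟨⟨d, h0, h1, h2, h3, h4, h5, h6, h7⟩, hb⟩
    have hb : ¬ 1 < s.natReg 5 := hb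
    exact ⟨⟨h3, fun p h8 h9 => h4 p h8 h9 (by omega), h5⟩, h6, h7⟩

/-- Outside the column of `i` the estimate is `0` and the growth factor is `1`, so only listed
leaves have to be touched. -/
theorem Input.nextWeight_of_notMem (η : ℝ) (x : EuclideanSpace ℝ (Fin n)) (w : Fin m → ℝ)
    (i : Fin n) {j : Fin m} (hj : j ∉ I.supp i) : I.nextWeight η x w i j = w j := by
  have : I.v j i = 0 := by
    by_contra h
    exact hj ((I.mem_supp i j).2 h)
  simp [Input.nextWeight, this]

theorem IsTree.congr {w : Fin m → ℝ} {s s' : Memory} (h : IsTree w s)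
    (h1 : s'.realArr 2 = s.realArr 2) (h2 : s'.natArr 0 = s.natArr 0) : IsTree w s' :=
  ⟨by rw [h1]; exact h.leaf, by rw [h1]; exact h.node, by rw [h2]; exact h.parent⟩

theorem updateWeights_spec {w : Fin m → ℝ} {x : EuclideanSpace ℝ (Fin n)} {s₀ : Memory}
    {i : Fin n} {L : ℕ} (hL : m ≤ 2 ^ L) (hw : IsTree w s₀) (hi : s₀.natReg 3 = i)
    (hx : ∀ i : Fin n, s₀.realArr 1 i = x i) :
    Achieves I updateWeights ((I.supp i).length * (24 * L + 80) + 10) s₀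
      (fun s => IsTree (I.nextWeight (I.eps / 8) x w i) s ∧
        (∀ r, r ≠ 4 → r ≠ 5 → s.natReg r = s₀.natReg r) ∧
        ∀ a, a ≠ 2 → s.realArr a = s₀.realArr a) := by
  classical
  set l := I.supp i with hl
  -- The weights after the first `k` entries of the column have been treated.
  set W : ℕ → Fin m → ℝ := fun k j =>
    if j ∈ l.take k then I.nextWeight (I.eps / 8) x w i j else w j with hW
  set J : ℕ → Memory → Prop := fun d s => s.natReg 4 + d = l.length ∧ IsTree (W (s.natReg 4)) s ∧
    (∀ r, r ≠ 4 → r ≠ 5 → s.natReg r = s₀.natReg r) ∧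
    ∀ a, a ≠ 2 → s.realArr a = s₀.realArr a with hJ
  have hlen : ∀ s : Memory, s.natReg 3 = i → (NatExpr.colSize (.reg 3)).eval I s = l.length := by
    intro s hs
    simp only [NatExpr.eval, hs, Fin.is_lt, dif_pos, Fin.eta, hl]
  have hloop := Achieves.loop (I := I) (b := columnTest) (P := columnBody) (c := 24 * L + 68)
    (J := J) (by
    rintro d s ⟨h1, h2, h3, h4⟩ hb
    have hs3 : s.natReg 3 = i := (h3 3 (by norm_num) (by norm_num)).trans hi
    have hb : s.natReg 4 < (NatExpr.colSize (.reg 3)).eval I s := hb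
    rw [hlen s hs3] at hb
    refine ⟨by omega, ?_⟩
    set p := s.natReg 4 with hp
    set j := l[p] with hj
    have hcol : (NatExpr.colAt (.reg 3) (.reg 4)).eval I s = j := by
      simp only [NatExpr.eval, hs3, Fin.is_lt, dif_pos, Fin.eta, ← hp]
      rw [List.getD_eq_getElem _ _ (by simpa using hb)]
      simp [hj, hl]
    -- The list has no repetitions, so no leaf is multiplied twice.
    have hjt : j ∉ l.take p := by
      intro hmem
      obtain ⟨q, hq, hqj⟩ := List.mem_take_iff_getElem.1 hmem
      have := (I.supp_nodup i).getElem_inj_iff.1 hqj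
      omega
    have hWsucc : ∀ j', W (p + 1) j' =
        if j' = j then I.nextWeight (I.eps / 8) x w i j' else W p j' := by
      intro j'
      simp only [hW, List.take_succ_eq_append_getElem hb, List.mem_append, List.mem_singleton,
        ← hj]
      by_cases h : j' = j
      · simp [h]
      · simp [h]
    set A : Memory → Prop := fun s' => s'.natReg 5 = m + j ∧
      (∀ r, r ≠ 5 → s'.natReg r = s.natReg r) ∧ s'.natArr = s.natArr ∧
      (∀ a, a ≠ 2 → s'.realArr a = s.realArr a) ∧
      ∀ q, s'.realArr 2 q = if q = m + j then I.nextWeight (I.eps / 8) x w i j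
        else s.realArr 2 q with hA
    set B : Memory → Prop := fun s' => IsTree (W (p + 1)) s' ∧
      (∀ r, r ≠ 5 → s'.natReg r = s.natReg r) ∧ ∀ a, a ≠ 2 → s'.realArr a = s.realArr a with hB
    have hτ : changeLeaf.time = 38 := rfl
    refine Achieves.mono (P := columnBody)
      (τ₁ := 1 + (changeLeaf.time + (1 + (24 * L + 24 + 4)))) (A := J (d - 1)) ?_ (by omega)
      fun _ h => h
    refine Achieves.seq (A := A) (Achieves.of_exec ⟨trivial, trivial, trivial⟩ le_rfl ?_)
      fun s₁ hs₁ => Achieves.seq (A := B) ?_ fun s₂ hs₂ => Achieves.of_exec trivial le_rfl ?_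
    · have hest : estimate.eval I (s.setNat 5 (m + j)) = I.eps / 8 * n * I.v j i * x i := by
        have e1 : (NatExpr.colAt (.reg 3) (.reg 4)).eval I (s.setNat 5 (m + j)) = j := by
          rw [← hcol]
          simp [NatExpr.eval, Memory.setNat]
        have e2 : (s.setNat 5 (m + j)).natReg 3 = i := by simpa [Memory.setNat] using hs3
        have e3 : (s.setNat 5 (m + j)).realArr 1 i = x i := by
          rw [← hx, ← h4 1 (by norm_num)]; rfl
        have e4 : (RealExpr.entry (.colAt (.reg 3) (.reg 4)) (.reg 3)).eval I
            (s.setNat 5 (m + j)) = I.v j i := by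
          have e5 : (NatExpr.reg 3).eval I (s.setNat 5 (m + j)) = i := e2
          simp [RealExpr.eval, e1, e5]
        simp only [estimate, stepSize, RealExpr.eval] at e4 ⊢
        rw [e4]
        simp only [NatExpr.eval, e2, e3, Nat.cast_ofNat]
      have hexec : changeLeaf.exec I s = ((s.setNat 5 (m + j)).setReal 0
          (estimate.eval I (s.setNat 5 (m + j)))).storeReal 2 (m + j)
          (s.realArr 2 (m + j) * (1 + estimate.eval I (s.setNat 5 (m + j)) +
            estimate.eval I (s.setNat 5 (m + j)) * estimate.eval I (s.setNat 5 (m + j)))) := by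
        have e5 : (NatExpr.add .num (.colAt (.reg 3) (.reg 4))).eval I s = m + j := by
          rw [NatExpr.eval, hcol]; rfl
        simp only [changeLeaf, Prog.exec, e5, RealExpr.eval]
        simp [NatExpr.eval, Memory.setNat, Memory.setReal]
      rw [hexec, hest]
      refine ⟨by simp [Memory.storeReal, Memory.setReal, Memory.setNat],
        fun r hr => by simp [Memory.storeReal, Memory.setReal, Memory.setNat, hr], rfl,
        fun a ha => by simp [Memory.storeReal, Memory.setReal, Memory.setNat, ha], fun q => ?_⟩
      have e6 : s.realArr 2 (m + j) = w j := by rw [h2.leaf]; simp [hW, hjt]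
      simp only [Memory.storeReal, Memory.setReal, Memory.setNat, Function.update_self,
        Function.update_apply]
      split_ifs
      · rw [e6, Input.nextWeight]; ring
      · rfl
    · obtain ⟨g1, g2, g3, g4, g5⟩ := hs₁
      refine (bubble_spec (I := I) (W (p + 1)) s₁ L hL (by omega) (by omega) ?_ ?_ ?_).mono le_rfl
        fun s' hs' => ⟨hs'.1, fun r hr => (hs'.2.1 r hr).trans (g2 r hr),
          fun a ha => (hs'.2.2 a ha).trans (g4 a ha)⟩
      · intro j'
        rw [g5, hWsucc]
        by_cases h : j' = j
        · simp [h]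
        · have : m + (j' : ℕ) ≠ m + j := by
            intro h'; exact h (Fin.ext (by omega))
          rw [if_neg this, if_neg h, h2.leaf]
      · intro q hq0 hqm hne
        rw [g1] at hne
        rw [g5, g5, g5, if_neg (by omega), if_neg (by omega), if_neg (by omega)]
        exact h2.node q hq0 hqm
      · rw [g3]; exact h2.parent
    · obtain ⟨g1, g2, g3⟩ := hs₂
      have g4 : s₂.natReg 4 = p := g2 4 (by norm_num)
      simp only [hJ, Prog.exec, NatExpr.eval, Memory.setNat, Function.update_self, g4]
      exact ⟨by omega, ⟨g1.leaf, g1.node, g1.parent⟩,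
        fun r hr hr' => by simpa [hr] using (g2 r hr').trans (h3 r hr hr'),
        fun a ha => (g3 a ha).trans (h4 a ha)⟩)
  refine Achieves.mono (Achieves.seq (Achieves.of_exec (Post := J l.length)
    trivial le_rfl ?_) fun s hs => hloop _ s hs) ?_ ?_
  · simp only [hJ, Prog.exec, Memory.setNat, NatExpr.eval, Function.update_self]
    refine ⟨by omega, ?_, fun r hr hr' => by simp [hr], by simp⟩
    have : W 0 = w := by ext j; simp [hW]
    rw [this]
    exact hw.congr rfl rfl
  · have h1 : columnTest.cost = 4 := rfl
    have h2 : (Prog.setNat 4 (.const 0)).time = 2 := rfl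
    rw [h1, h2]
    have : l.length * (24 * L + 68 + 4 + 1) ≤ l.length * (24 * L + 80) :=
      Nat.mul_le_mul_left _ (by omega)
    omega
  · rintro s ⟨⟨d, h1, h2, h3, h4⟩, hb⟩
    have hb : ¬ s.natReg 4 < (NatExpr.colSize (.reg 3)).eval I s := hb
    rw [hlen s ((h3 3 (by norm_num) (by norm_num)).trans hi)] at hb
    refine ⟨?_, h3, h4⟩
    have h5 : W (s.natReg 4) = I.nextWeight (I.eps / 8) x w i := by
      ext j
      simp only [hW]
      rw [List.take_of_length_le (by omega)]
      split_ifs with h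
      · rfl
      · exact (Input.nextWeight_of_notMem _ _ _ _ h).symm
    rwa [h5] at h2

theorem updatePoint_spec {A x : EuclideanSpace ℝ (Fin n)} {s₀ : Memory} {t : ℕ} {j : Fin m}
    (hA : ∀ i : Fin n, s₀.realArr 0 i = A i) (hx : ∀ i : Fin n, s₀.realArr 1 i = x i)
    (ht : s₀.natReg 7 = t) (hj : s₀.natReg 1 = m + j) :
    Achieves I updatePoint (100 * n + 10) s₀
      (fun s => (∀ i : Fin n, s.realArr 0 i = nextAverage t A x i) ∧
        (∀ i : Fin n, s.realArr 1 i = I.nextPoint (I.eps / 8) x j i) ∧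
        s.realArr 2 = s₀.realArr 2 ∧ s.natArr = s₀.natArr ∧
        ∀ r, r ≠ 6 → s.natReg r = s₀.natReg r) := by
  set J : ℕ → Memory → Prop := fun d s => s.natReg 6 + d = n ∧
    (∀ i : Fin n, s.realArr 0 i = if (i : ℕ) < s.natReg 6 then nextAverage t A x i else A i) ∧
    (∀ i : Fin n, s.realArr 1 i =
      if (i : ℕ) < s.natReg 6 then I.nextPoint (I.eps / 8) x j i else x i) ∧
    s.realArr 2 = s₀.realArr 2 ∧ s.natArr = s₀.natArr ∧
    ∀ r, r ≠ 6 → s.natReg r = s₀.natReg r with hJ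
  have hloop := Achieves.loop (I := I) (b := pointTest) (P := pointBody) (c := pointBody.time)
    (J := J) (by
    rintro d s ⟨h1, h2, h3, h4, h5, h6⟩ hb
    have hb : s.natReg 6 < n := hb
    refine ⟨by omega, Achieves.of_exec
      ⟨trivial, trivial, ⟨trivial, trivial, trivial⟩, trivial⟩ le_rfl ?_⟩
    set c : Fin n := ⟨s.natReg 6, hb⟩ with hc
    have hcv : s.natReg 6 = c := rfl
    have hA' : s.realArr 0 c = A c := by rw [h2]; simp [hc]
    have hx' : s.realArr 1 c = x c := by rw [h3]; simp [hc]
    have ht' : s.natReg 7 = t := (h6 7 (by norm_num)).trans ht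
    have hj' : s.natReg 1 = m + j := (h6 1 (by norm_num)).trans hj
    have hexec : pointBody.exec I s =
        (((s.storeReal 0 c (nextAverage t A x c)).setReal 1
          (x c - I.eps / 8 * (I.v' c + I.v j c))).storeReal 1 c
          (I.nextPoint (I.eps / 8) x j c)).setNat 6 (c + 1) := by
      have e1 : m + (j : ℕ) - m = j := by omega
      simp only [pointBody, Prog.exec, RealExpr.eval, NatExpr.eval, Test.Holds, stepSize,
        negRadius, radiusExpr, Memory.storeReal, Memory.setReal, Memory.setNat, hcv, hj', ht',
        Function.update_self, hA', e1, Fin.is_lt, and_self, dif_pos, Fin.eta, Nat.cast_one,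
        Nat.cast_zero, zero_sub, Nat.cast_ofNat, nextAverage,
        Function.update_of_ne (show (1 : ℕ) ≠ 0 by norm_num), hx']
      by_cases g1 : x c - I.eps / 8 * (I.v' c + I.v j c) < -(1 / √(n : ℝ))
      · have e2 : I.nextPoint (I.eps / 8) x j c = -(1 / √(n : ℝ)) := if_pos g1
        simp only [if_pos g1, e2]
        rfl
      · by_cases g2 : 1 / √(n : ℝ) < x c - I.eps / 8 * (I.v' c + I.v j c)
        · have e2 : I.nextPoint (I.eps / 8) x j c = 1 / √(n : ℝ) :=
            (if_neg g1).trans (if_pos g2)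
          simp only [if_neg g1, if_pos g2, e2]
          rfl
        · have e2 : I.nextPoint (I.eps / 8) x j c = x c - I.eps / 8 * (I.v' c + I.v j c) :=
            (if_neg g1).trans (if_neg g2)
          simp only [if_neg g1, if_neg g2, e2]
          rfl
    rw [hexec]
    have e : ∀ i : Fin n, (i : ℕ) < c + 1 ↔ i = c ∨ (i : ℕ) < c := fun i => by
      rw [Fin.ext_iff]; omega
    refine ⟨?_, fun i => ?_, fun i => ?_, ?_, ?_, fun r hr => ?_⟩
    · simp only [Memory.setNat, Function.update_self]; omega
    · simp only [Memory.setNat, Memory.storeReal, Memory.setReal, Function.update_self, e]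
      rw [Function.update_of_ne (by norm_num), Function.update_self, Function.update_apply]
      by_cases hi : i = c
      · simp [hi]
      · rw [if_neg (by rwa [Fin.val_inj]), h2]
        simp only [hi, false_or]
        rfl
    · simp only [Memory.setNat, Memory.storeReal, Memory.setReal, Function.update_self, e]
      rw [Function.update_of_ne (by norm_num : (1 : ℕ) ≠ 0), Function.update_apply]
      by_cases hi : i = c
      · simp [hi]
      · rw [if_neg (by rwa [Fin.val_inj]), h3]
        simp only [hi, false_or]
        rfl
    · simpa [Memory.setNat, Memory.storeReal, Memory.setReal] using h4
    · exact h5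
    · simpa [Memory.setNat, Memory.storeReal, Memory.setReal, hr] using h6 r hr)
  refine Achieves.mono (Achieves.seq (Achieves.of_exec (Post := J n)
    trivial le_rfl ?_) fun s hs => hloop _ s hs) ?_ ?_
  · simp only [hJ, Prog.exec, Memory.setNat, NatExpr.eval, Function.update_self]
    exact ⟨by omega, by simpa using hA, by simpa using hx, by simp, by simp, fun r hr => by simp [hr]⟩
  · have h1 : pointTest.cost = 3 := rfl
    have h2 : (Prog.setNat 6 (.const 0)).time = 2 := rfl
    have h3 : pointBody.time = 83 := rfl
    rw [h1, h2, h3]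
    omega
  · rintro s ⟨⟨d, h1, h2, h3, h4, h5, h6⟩, hb⟩
    have hb : ¬ s.natReg 6 < n := hb
    have e : ∀ i : Fin n, (i : ℕ) < s.natReg 6 := fun i => by omega
    exact ⟨fun i => by rw [h2, if_pos (e i)], fun i => by rw [h3, if_pos (e i)], h4, h5, h6⟩

/-! ## Sampling -/

section Heap

/-- The sum over the leaves below a node, for the leaves `m, ..., 2 m - 1`. -/
noncomputable def heapSum (m : ℕ) (f : ℕ → ℝ) (p : ℕ) : ℝ :=
  if 0 < p ∧ p < m then heapSum m f (p + p) + heapSum m f (p + p + 1) else f p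
termination_by m - p

theorem heapSum_node {f : ℕ → ℝ} {p : ℕ} (h0 : 0 < p) (hm : p < m) :
    heapSum m f p = heapSum m f (p + p) + heapSum m f (p + p + 1) := by
  rw [heapSum, if_pos ⟨h0, hm⟩]

theorem heapSum_leaf {f : ℕ → ℝ} {p : ℕ} (hm : m ≤ p) : heapSum m f p = f p := by
  rw [heapSum, if_neg (by omega)]

/-- The sum of `S` over the window `k, ..., 2k - 1` does not depend on `k`: passing to `k + 1`
removes the node `k` and adds its two children. This covers every `m`, not only powers of two. -/
theorem heap_root {S : ℕ → ℝ} (hm : 0 < m)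
    (hS : ∀ p, 0 < p → p < m → S p = S (p + p) + S (p + p + 1)) :
    S 1 = ∑ j : Fin m, S (m + j) := by
  have key : ∀ k, 0 < k → k ≤ m → S 1 = ∑ j ∈ Finset.range k, S (k + j) := by
    intro k hk
    induction k, hk using Nat.le_induction with
    | base => simp
    | succ k hk ih =>
      intro hkm
      rw [ih (by omega)]
      have h1 : ∑ j ∈ Finset.range k, S (k + j) + S (k + k) + S (k + k + 1) =
          ∑ j ∈ Finset.range (k + 2), S (k + j) := by
        rw [Finset.sum_range_succ, Finset.sum_range_succ, add_assoc k k 1]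
      have h2 : ∑ j ∈ Finset.range (k + 2), S (k + j) =
          ∑ j ∈ Finset.range (k + 1), S (k + 1 + j) + S k := by
        rw [Finset.sum_range_succ', add_zero]
        simp only [add_assoc, add_comm 1]
      linarith [hS k hk (by omega)]
  rw [key m hm le_rfl, Finset.sum_range]

theorem heap_pos {S : ℕ → ℝ} (hS : ∀ p, 0 < p → p < m → S p = S (p + p) + S (p + p + 1))
    (hleaf : ∀ j : Fin m, 0 < S (m + j)) : ∀ p, 0 < p → p < m + m → 0 < S p := by
  intro p
  induction h : m - p using Nat.strong_induction_on generalizing p with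
  | _ d ih =>
    intro h0 h1
    rcases lt_or_ge p m with hp | hp
    · rw [hS p h0 hp]
      exact add_pos (ih (m - (p + p)) (by omega) _ rfl (by omega) (by omega))
        (ih (m - (p + p + 1)) (by omega) _ rfl (by omega) (by omega))
    · have := hleaf ⟨p - m, by omega⟩
      rwa [show m + (p - m) = p by omega] at this

end Heap

variable {Φ : Memory → ℝ≥0∞} {K : List Prog} {s₀ : Memory} {τ : ℕ}

theorem Bounded.top {s : Memory} : Bounded I Φ K s τ ⊤ := ⟨0, fun _ => le_top⟩

theorem Bounded.toss_real {s : Memory} {x : ℕ} {p : RealExpr} {v₁ v₀ : ℝ} (hv₁ : 0 ≤ v₁)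
    (hv₀ : 0 ≤ v₀) (h0 : 0 ≤ p.eval I s) (h1 : p.eval I s ≤ 1)
    (ht : Bounded I Φ K (s.setNat x 1) τ (ENNReal.ofReal v₁))
    (hf : Bounded I Φ K (s.setNat x 0) τ (ENNReal.ofReal v₀)) :
    Bounded I Φ (.toss x p :: K) s (p.cost + 1 + τ)
      (ENNReal.ofReal (p.eval I s * v₁ + (1 - p.eval I s) * v₀)) := by
  have := Bounded.toss h0 h1 ht hf
  rwa [← ENNReal.ofReal_mul h0, ← ENNReal.ofReal_mul (by linarith),
    ← ENNReal.ofReal_add (mul_nonneg h0 hv₁) (mul_nonneg (by linarith) hv₀)] at this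

/-- With `G` the partial sums of the weighted payoffs, `G p / S p` is the conditional mean of the
payoff given that the walk visits `p`. It is preserved by a step to the children with probabilities
proportional to `S`. The index at least doubles in each step, so `d` steps reach a leaf once `m ≤ p
2^d`. -/
theorem walk_spec {S G : ℕ → ℝ}
    (hS : ∀ p, 0 < p → p < m → S p = S (p + p) + S (p + p + 1))
    (hS0 : ∀ p, 0 < p → p < m + m → 0 < S p)
    (hG : ∀ p, 0 < p → p < m → G p = G (p + p) + G (p + p + 1))
    (hG0 : ∀ p, 0 < p → p < m + m → 0 ≤ G p)
    (hK : ∀ (j : Fin m) s, s.natReg 1 = m + j →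
      (∀ r, r ≠ 1 → r ≠ 2 → s.natReg r = s₀.natReg r) → s.natArr = s₀.natArr →
      s.realArr = s₀.realArr → Bounded I Φ K s τ (ENNReal.ofReal (G (m + j) / S (m + j))))
    (hs₀ : s₀.realArr 2 = S) (d : ℕ) :
    ∀ s : Memory, 0 < s.natReg 1 → s.natReg 1 < m + m → m ≤ s.natReg 1 * 2 ^ d →
      (∀ r, r ≠ 1 → r ≠ 2 → s.natReg r = s₀.natReg r) → s.natArr = s₀.natArr →
      s.realArr = s₀.realArr → Bounded I Φ (.loop walkTest walkBody :: K) s (40 * d + 10 + τ)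
        (ENNReal.ofReal (G (s.natReg 1) / S (s.natReg 1))) := by
  have hτ : walkTest.cost = 3 := rfl
  have hexit : ∀ d s, 0 < s.natReg 1 → s.natReg 1 < m + m → m ≤ s.natReg 1 →
      (∀ r, r ≠ 1 → r ≠ 2 → s.natReg r = s₀.natReg r) → s.natArr = s₀.natArr →
      s.realArr = s₀.realArr → Bounded I Φ (.loop walkTest walkBody :: K) s (40 * d + 10 + τ)
        (ENNReal.ofReal (G (s.natReg 1) / S (s.natReg 1))) := by
    intro d s h1 h2 h3 h4 h5 h6
    have e : s.natReg 1 = m + (⟨s.natReg 1 - m, by omega⟩ : Fin m) := by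
      simp only; omega
    have := hK ⟨s.natReg 1 - m, by omega⟩ s e h4 h5 h6
    rw [← e] at this
    exact (Bounded.loop_exit (b := walkTest) (not_lt.2 h3) this).mono (by omega) le_rfl
  induction d with
  | zero =>
    intro s h1 h2 h3
    exact hexit 0 s h1 h2 (by simpa using h3)
  | succ d ih =>
    intro s h1 h2 h3 h4 h5 h6
    rcases lt_or_ge (s.natReg 1) m with hp | hp
    swap
    · exact hexit _ s h1 h2 hp h4 h5 h6
    set p := s.natReg 1 with hpdef
    rw [pow_succ] at h3
    have hstep : ∀ (b : ℕ) (q : ℕ), (if 0 < b then p + p else p + p + 1) = q →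
        Bounded I Φ (.ite (.natLt (.const 0) (.reg 2)) (.setNat 1 (left 1)) (.setNat 1 (right 1))
          :: .loop walkTest walkBody :: K) (s.setNat 2 b) (14 + (40 * d + 10 + τ))
          (ENNReal.ofReal (G q / S q)) := by
      intro b q hq
      refine Achieves.straight (P := .ite (.natLt (.const 0) (.reg 2)) (.setNat 1 (left 1))
        (.setNat 1 (right 1))) ⟨trivial, trivial⟩ Φ _ _ _ fun s' hs' => ?_
      have hs1 : s' = (s.setNat 2 b).setNat 1 q := by
        rw [hs', ← hq]
        simp only [Prog.exec, Test.Holds, NatExpr.eval, left, right, Memory.setNat,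
          Function.update_self, Function.update_of_ne (show (1 : ℕ) ≠ 2 by norm_num), ← hpdef]
        split_ifs <;> rfl
      have hq1 : s'.natReg 1 = q := by rw [hs1]; simp [Memory.setNat]
      have hq2 : p + p ≤ q ∧ q ≤ p + p + 1 := by rw [← hq]; split_ifs <;> omega
      rw [← hq1]
      refine ih s' (by omega) (by omega) ?_ ?_ ?_ ?_
      · rw [hq1]
        refine h3.trans ?_
        rw [mul_comm (2 ^ d) 2, ← mul_assoc]
        exact Nat.mul_le_mul_right _ (by omega)
      · intro r hr1 hr2
        rw [hs1, ← h4 r hr1 hr2]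
        simp [Memory.setNat, hr1, hr2]
      · rw [hs1, ← h5]; rfl
      · rw [hs1, ← h6]; rfl
    have hSp := hS0 p h1 h2
    have hS1 := hS0 (p + p) (by omega) (by omega)
    have hS2 := hS0 (p + p + 1) (by omega) (by omega)
    have hprob : (RealExpr.div (.arr 2 (left 1)) (.arr 2 (.reg 1))).eval I s =
        S (p + p) / S p := by
      simp only [RealExpr.eval, NatExpr.eval, left, h6, hs₀, ← hpdef]
    have hbody := Bounded.toss_real (I := I) (Φ := Φ) (s := s) (x := 2)
      (p := .div (.arr 2 (left 1)) (.arr 2 (.reg 1)))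
      (div_nonneg (hG0 (p + p) (by omega) (by omega)) hS1.le)
      (div_nonneg (hG0 (p + p + 1) (by omega) (by omega)) hS2.le)
      (by rw [hprob]; positivity)
      (by rw [hprob, div_le_one hSp, hS p h1 hp]; linarith)
      (hstep 1 (p + p) rfl) (hstep 0 (p + p + 1) rfl)
    have hval : S (p + p) / S p * (G (p + p) / S (p + p)) +
        (1 - S (p + p) / S p) * (G (p + p + 1) / S (p + p + 1)) = G p / S p := by
      have : 1 - S (p + p) / S p = S (p + p + 1) / S p := by
        rw [eq_div_iff hSp.ne', sub_mul, div_mul_cancel₀ _ hSp.ne', hS p h1 hp]; ring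
      rw [this, hG p h1 hp]
      field_simp
    rw [hprob, hval] at hbody
    have hc : (RealExpr.div (.arr 2 (left 1)) (.arr 2 (.reg 1))).cost = 7 := rfl
    exact (Bounded.loop_enter (b := walkTest) (P := walkBody) hp (Bounded.seq hbody)).mono
      (by omega) le_rfl

theorem sampleVector_spec {w : Fin m → ℝ} {L : ℕ} (hm : 0 < m) (hL : m ≤ 2 ^ L)
    (htree : IsTree w s₀) (hw : ∀ j, 0 < w j) {g : Fin m → ℝ} (hg : ∀ j, 0 ≤ g j)
    (hK : ∀ (j : Fin m) s, s.natReg 1 = m + j →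
      (∀ r, r ≠ 1 → r ≠ 2 → s.natReg r = s₀.natReg r) → s.natArr = s₀.natArr →
      s.realArr = s₀.realArr → Bounded I Φ K s τ (ENNReal.ofReal (g j))) :
    Bounded I Φ (sampleVector :: K) s₀ (40 * L + 20 + τ)
      (ENNReal.ofReal (∑ l, w l / (∑ l, w l) * g l)) := by
  set S := s₀.realArr 2 with hS
  -- On the leaf `m + j` this is `w j * g j`, so the quotient at the root is the weighted mean of
  -- `g`.
  set f : ℕ → ℝ := fun p => S p * if h : p - m < m then g ⟨p - m, h⟩ else 0 with hf
  set G := heapSum m f with hG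
  have hSl : ∀ j : Fin m, S (m + j) = w j := htree.leaf
  have hSn : ∀ p, 0 < p → p < m → S p = S (p + p) + S (p + p + 1) := htree.node
  have hS0 : ∀ p, 0 < p → p < m + m → 0 < S p :=
    heap_pos hSn fun j => by rw [hSl]; exact hw j
  have hGleaf : ∀ j : Fin m, G (m + j) = w j * g j := fun j => by
    have : m + (j : ℕ) - m = j := by omega
    rw [hG, heapSum_leaf (by omega), hf]
    simp only [this, Fin.is_lt, dif_pos, Fin.eta]
    rw [hSl]
  have hG0 : ∀ p, 0 < p → p < m + m → 0 ≤ G p := by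
    intro p
    induction h : m - p using Nat.strong_induction_on generalizing p with
    | _ d ih =>
      intro h0 h1
      rcases lt_or_ge p m with hp | hp
      · rw [hG, heapSum_node h0 hp]
        exact add_nonneg (ih (m - (p + p)) (by omega) _ rfl (by omega) (by omega))
          (ih (m - (p + p + 1)) (by omega) _ rfl (by omega) (by omega))
      · have := hGleaf ⟨p - m, by omega⟩
        rw [show m + (p - m) = p by omega] at this
        rw [this]
        exact mul_nonneg (hw _).le (hg _)
  have hroot : G 1 / S 1 = ∑ l, w l / (∑ l, w l) * g l := by
    rw [heap_root (S := S) hm hSn, heap_root (S := G) hm fun p h0 h1 => heapSum_node h0 h1,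
      Finset.sum_div]
    refine Finset.sum_congr rfl fun l _ => ?_
    rw [hGleaf, Finset.sum_congr rfl fun j _ => hSl j]
    ring
  have hstart := walk_spec (I := I) (Φ := Φ) (K := K) (τ := τ) (s₀ := s₀) (S := S) (G := G)
    hSn hS0 (fun p h0 h1 => heapSum_node h0 h1) hG0
    (fun j s h1 h2 h3 h4 => by
      have e : G (m + j) / S (m + j) = g j := by
        rw [hGleaf, hSl, mul_div_cancel_left₀ _ (hw j).ne']
      rw [e]
      exact hK j s h1 h2 h3 h4) rfl L (s₀.setNat 1 1) (by simp [Memory.setNat])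
    (by simp [Memory.setNat]; omega) (by simpa [Memory.setNat] using hL)
    (fun r hr _ => by simp [Memory.setNat, hr]) rfl rfl
  have e : (s₀.setNat 1 1).natReg 1 = 1 := by simp [Memory.setNat]
  rw [e, hroot] at hstart
  exact (Bounded.seq (Achieves.straight (P := .setNat 1 (.const 1)) trivial Φ _ _ _
    fun s' hs' => by rw [hs']; exact hstart)).mono
    (by have : (Prog.setNat 1 (.const 1)).time = 2 := rfl
        omega) le_rfl

/-- Acceptance of the largest remaining coordinate with probability one over the number of remaining
ones, followed by a uniform choice among the rest, is a uniform choice. -/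
theorem pick_spec {g : ℕ → ℝ} (hg : ∀ i, 0 ≤ g i)
    (hK : ∀ (i : ℕ) s, i < n → s.natReg 3 = i →
      (∀ r, r ≠ 2 → r ≠ 3 → s.natReg r = s₀.natReg r) → s.natArr = s₀.natArr →
      s.realArr = s₀.realArr → Bounded I Φ K s τ (ENNReal.ofReal (g i))) (q : ℕ) :
    ∀ s : Memory, q < n → s.natReg 3 = q + 1 → s.natReg 2 = 0 →
      (∀ r, r ≠ 2 → r ≠ 3 → s.natReg r = s₀.natReg r) → s.natArr = s₀.natArr →
      s.realArr = s₀.realArr → Bounded I Φ (.loop pickTest pickBody :: K) s (30 * q + 30 + τ)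
        (ENNReal.ofReal (1 / ((q : ℝ) + 1) * ∑ i ∈ Finset.range (q + 1), g i)) := by
  have hτ : pickTest.cost = 3 := rfl
  have hc : (RealExpr.div (.ofNat (.const 1)) (.ofNat (.add (.reg 3) (.const 1)))).cost = 7 := rfl
  have hτ1 : (Prog.setNat 3 (.sub (.reg 3) (.const 1))).time = 4 := rfl
  induction q with
  | zero =>
    intro s hn h3 h2 h4 h5 h6
    have hhead : Bounded I Φ (.loop pickTest pickBody :: K) ((s.setNat 3 0).setNat 2 1)
        (4 + τ) (ENNReal.ofReal (g 0)) :=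
      Bounded.loop_exit (b := pickTest)
        (by simp [pickTest, Test.Holds, NatExpr.eval, Memory.setNat])
        (hK 0 _ hn (by simp [Memory.setNat])
          (fun r hr2 hr3 => by rw [← h4 r hr2 hr3]; simp [Memory.setNat, hr2, hr3]) h5 h6)
    have hp : (RealExpr.div (.ofNat (.const 1)) (.ofNat (.add (.reg 3) (.const 1)))).eval I
        (s.setNat 3 0) = 1 := by simp [RealExpr.eval, NatExpr.eval, Memory.setNat]
    -- The coin is certain here; the tails branch carries the trivial bound `⊤`, and `0 * ⊤ = 0`.
    have htoss := Bounded.toss (I := I) (x := 2)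
      (p := .div (.ofNat (.const 1)) (.ofNat (.add (.reg 3) (.const 1))))
      (by rw [hp]; norm_num) hp.le hhead Bounded.top
    rw [hp, sub_self, ENNReal.ofReal_zero, zero_mul, add_zero, ENNReal.ofReal_one, one_mul]
      at htoss
    have hset := Achieves.straight (I := I) (P := .setNat 3 (.sub (.reg 3) (.const 1))) (s := s)
      trivial Φ _ _ _ fun s' hs' => by
        have : s' = s.setNat 3 0 := by rw [hs']; simp [Prog.exec, NatExpr.eval, h3]
        rw [this]
        exact htoss
    refine (Bounded.loop_enter (b := pickTest) (P := pickBody) ?_ (Bounded.seq hset)).mono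
      (by omega) (by simp)
    simp [pickTest, Test.Holds, NatExpr.eval, h2]
  | succ q ih =>
    intro s hn h3 h2 h4 h5 h6
    have hq : (0 : ℝ) < (q : ℝ) + 1 := by positivity
    have hhead : Bounded I Φ (.loop pickTest pickBody :: K) ((s.setNat 3 (q + 1)).setNat 2 1)
        (4 + τ) (ENNReal.ofReal (g (q + 1))) :=
      Bounded.loop_exit (b := pickTest)
        (by simp [pickTest, Test.Holds, NatExpr.eval, Memory.setNat])
        (hK (q + 1) _ hn (by simp [Memory.setNat])
          (fun r hr2 hr3 => by rw [← h4 r hr2 hr3]; simp [Memory.setNat, hr2, hr3]) h5 h6)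
    have htail := ih ((s.setNat 3 (q + 1)).setNat 2 0) (by omega) (by simp [Memory.setNat])
      (by simp [Memory.setNat])
      (fun r hr2 hr3 => by rw [← h4 r hr2 hr3]; simp [Memory.setNat, hr2, hr3]) h5 h6
    have hp : (RealExpr.div (.ofNat (.const 1)) (.ofNat (.add (.reg 3) (.const 1)))).eval I
        (s.setNat 3 (q + 1)) = 1 / ((q : ℝ) + 1 + 1) := by
      simp [RealExpr.eval, NatExpr.eval, Memory.setNat]
    have htoss := Bounded.toss_real (I := I) (x := 2)
      (p := .div (.ofNat (.const 1)) (.ofNat (.add (.reg 3) (.const 1))))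
      (hg (q + 1)) (mul_nonneg (by positivity) (Finset.sum_nonneg fun i _ => hg i))
      (by rw [hp]; positivity) (by rw [hp, div_le_one (by positivity)]; linarith)
      (hhead.mono (by omega) le_rfl) htail
    have hval : 1 / ((q : ℝ) + 1 + 1) * g (q + 1) + (1 - 1 / ((q : ℝ) + 1 + 1)) *
        (1 / ((q : ℝ) + 1) * ∑ i ∈ Finset.range (q + 1), g i) =
        1 / (((q + 1 : ℕ) : ℝ) + 1) * ∑ i ∈ Finset.range (q + 1 + 1), g i := by
      rw [Finset.sum_range_succ g (q + 1)]
      push_cast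
      field_simp
      ring
    rw [hp, hval] at htoss
    have hset := Achieves.straight (I := I) (P := .setNat 3 (.sub (.reg 3) (.const 1))) (s := s)
      trivial Φ _ _ _ fun s' hs' => by
        have : s' = s.setNat 3 (q + 1) := by rw [hs']; simp [Prog.exec, NatExpr.eval, h3]
        rw [this]
        exact htoss
    refine (Bounded.loop_enter (b := pickTest) (P := pickBody) ?_ (Bounded.seq hset)).mono
      (by omega) le_rfl
    simp [pickTest, Test.Holds, NatExpr.eval, h2]

theorem sampleCoordinate_spec (hn : 0 < n) {g : Fin n → ℝ} (hg : ∀ i, 0 ≤ g i)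
    (hK : ∀ (i : Fin n) (s : Memory), s.natReg 3 = i →
      (∀ r, r ≠ 2 → r ≠ 3 → s.natReg r = s₀.natReg r) → s.natArr = s₀.natArr →
      s.realArr = s₀.realArr → Bounded I Φ K s τ (ENNReal.ofReal (g i))) :
    Bounded I Φ (sampleCoordinate :: K) s₀ (30 * n + 20 + τ)
      (ENNReal.ofReal (∑ i : Fin n, 1 / (n : ℝ) * g i)) := by
  set g' : ℕ → ℝ := fun i => if h : i < n then g ⟨i, h⟩ else 0 with hg'
  have h0 : ∀ i, 0 ≤ g' i := fun i => by
    simp only [hg']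
    split_ifs
    · exact hg _
    · exact le_rfl
  have hpick := pick_spec (I := I) (Φ := Φ) (K := K) (τ := τ) (s₀ := s₀) h0
    (fun i s hi h1 h2 h3 h4 => by
      have := hK ⟨i, hi⟩ s h1 h2 h3 h4
      simpa only [hg', hi, dif_pos] using this) (n - 1) ((s₀.setNat 3 n).setNat 2 0) (by omega)
    (by simp [Memory.setNat]; omega) (by simp [Memory.setNat])
    (fun r hr2 hr3 => by simp [Memory.setNat, hr2, hr3]) rfl rfl
  have e1 : n - 1 + 1 = n := by omega
  have e2 : ((n - 1 : ℕ) : ℝ) + 1 = n := by exact_mod_cast e1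
  have e3 : ∑ i ∈ Finset.range n, g' i = ∑ i : Fin n, g i := by
    rw [Finset.sum_range]
    exact Finset.sum_congr rfl fun i _ => by simp [hg']
  rw [e1, e2, e3, Finset.mul_sum] at hpick
  refine (Bounded.seq (Achieves.straight (P := .setNat 3 .dim) trivial Φ _
    (1 + ((Prog.setNat 2 (.const 0)).time + (30 * (n - 1) + 30 + τ))) _ fun s hs =>
    Bounded.seq (Achieves.straight (P := .setNat 2 (.const 0)) trivial Φ _ (30 * (n - 1) + 30 + τ) _
      fun s' hs' => ?_))).mono ?_ le_rfl
  · rw [hs', hs]; exact hpick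
  · have h1 : (Prog.setNat 2 (.const 0)).time = 2 := rfl
    have h2 : (Prog.setNat 3 .dim).time = 2 := rfl
    omega

/-! ## The main loop -/

/-- The memory `s` represents the state of the method before round `t`. -/
structure Represents (t : ℕ) (A x : EuclideanSpace ℝ (Fin n)) (w : Fin m → ℝ) (s : Memory) :
    Prop where
  log : s.natReg 0 = Nat.clog 2 (n + m)
  round : s.natReg 7 = t
  average : ∀ i : Fin n, s.realArr 0 i = A i
  point : ∀ i : Fin n, s.realArr 1 i = x i
  tree : IsTree w s

/-- A bound for the time of one round. -/
def roundTime (n k L : ℕ) : ℕ := 40 * L + 130 * n + k * (24 * L + 80) + 68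

theorem le_two_pow_clog (n m : ℕ) : n + m ≤ 2 ^ Nat.clog 2 (n + m) :=
  Nat.le_pow_clog (by norm_num) _

/-- The value of the continuation is carried backwards through the round: past the coin-free updates
it is unchanged, and the two samplings average it over `i` and then over `l`. The result is the
double mean of `mean_potential_le`. -/
theorem round_spec {Φ : Memory → ℝ≥0∞} {K : List Prog} {τ k t : ℕ} {s : Memory}
    {A x : EuclideanSpace ℝ (Fin n)} {w : Fin m → ℝ} (hn : 0 < n) (hm : 0 < m)
    (hk : ∀ i, (I.supp i).length ≤ k) (hs : Represents t A x w s) (hw : ∀ j, 0 < w j)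
    {g : Fin m → Fin n → ℝ} (hg : ∀ l i, 0 ≤ g l i)
    (hK : ∀ l i s', Represents (t + 1) (nextAverage t A x) (I.nextPoint (I.eps / 8) x l)
      (I.nextWeight (I.eps / 8) x w i) s' → Bounded I Φ K s' τ (ENNReal.ofReal (g l i))) :
    Bounded I Φ (round :: K) s (roundTime n k (Nat.clog 2 (n + m)) + τ)
      (ENNReal.ofReal (∑ l, w l / (∑ l, w l) * ∑ i : Fin n, 1 / (n : ℝ) * g l i)) := by
  set L := Nat.clog 2 (n + m) with hL
  have hmL : m ≤ 2 ^ L := (Nat.le_add_left m n).trans (le_two_pow_clog n m)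
  have hn0 : (0 : ℝ) ≤ 1 / (n : ℝ) := by positivity
  have htick : (Prog.setNat 7 (.add (.reg 7) (.const 1))).time = 4 := rfl
  have hmain := Bounded.seq (sampleVector_spec (I := I) (Φ := Φ)
    (K := .seq sampleCoordinate (.seq updateWeights (.seq updatePoint
      (.setNat 7 (.add (.reg 7) (.const 1))))) :: K)
    (τ := 1 + (30 * n + 20 + (1 + (k * (24 * L + 80) + 10 + (1 + (100 * n + 10 + (4 + τ))))))) hm hmL
    hs.tree hw (g := fun l => ∑ i : Fin n, 1 / (n : ℝ) * g l i)
    (fun l => Finset.sum_nonneg fun i _ => mul_nonneg hn0 (hg l i)) fun l s₁ h1 h2 h3 h4 =>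
    Bounded.seq (sampleCoordinate_spec hn (hg l) fun i s₂ g1 g2 g3 g4 => Bounded.seq ?_))
  · refine hmain.mono ?_ le_rfl
    unfold roundTime
    omega
  · have ht2 : IsTree w s₂ := hs.tree.congr (by rw [g4, h4]) (by rw [g3, h3])
    have hr : ∀ r, r ≠ 1 → r ≠ 2 → r ≠ 3 → s₂.natReg r = s.natReg r :=
      fun r e1 e2 e3 => (g2 r e2 e3).trans (h2 r e1 e2)
    have hl : s₂.natReg 1 = m + l := (g2 1 (by norm_num) (by norm_num)).trans h1
    have hW := (updateWeights_spec (I := I) (s₀ := s₂) (x := x) hmL ht2 g1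
      (by rw [g4, h4]; exact hs.point)).mono (τ := k * (24 * L + 80) + 10)
      (Nat.add_le_add_right (Nat.mul_le_mul_right _ (hk i)) _) fun _ h => h
    refine hW Φ _ _ _ fun s₃ ⟨f1, f2, f3⟩ => Bounded.seq ?_
    refine updatePoint_spec (I := I) (s₀ := s₃) (t := t) (A := A) (x := x) (j := l)
      (by rw [f3 0 (by norm_num), g4, h4]; exact hs.average)
      (by rw [f3 1 (by norm_num), g4, h4]; exact hs.point)
      (by rw [f2 7 (by norm_num) (by norm_num), hr 7 (by norm_num) (by norm_num) (by norm_num)]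
          exact hs.round)
      (by rw [f2 1 (by norm_num) (by norm_num)]; exact hl) Φ _ _ _
      fun s₄ ⟨e1, e2, e3, e4, e5⟩ => ?_
    refine Achieves.straight (P := .setNat 7 (.add (.reg 7) (.const 1))) trivial Φ _ _ _
      fun s₅ hs₅ => hK l i s₅ ?_
    have h7 : s₄.natReg 7 = t := by
      rw [e5 7 (by norm_num), f2 7 (by norm_num) (by norm_num),
        hr 7 (by norm_num) (by norm_num) (by norm_num)]
      exact hs.round
    have h0 : s₄.natReg 0 = L := by
      rw [e5 0 (by norm_num), f2 0 (by norm_num) (by norm_num),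
        hr 0 (by norm_num) (by norm_num) (by norm_num)]
      exact hs.log
    have : s₅ = s₄.setNat 7 (t + 1) := by rw [hs₅]; simp [Prog.exec, NatExpr.eval, h7]
    rw [this]
    exact ⟨by simpa [Memory.setNat] using h0, by simp [Memory.setNat], e1, e2,
      f1.congr e3 (by rw [← e4]; rfl)⟩

open Classical in
/-- The indicator of a bad output. -/
noncomputable def Input.failure (I : Input n m) (OPT : ℝ) (s : Memory) : ℝ≥0∞ :=
  if s.output n ∈ cube n ∧ I.objective (s.output n) ≤ I.eps + OPT then 0 else 1

/-- Backward induction on the number `d` of remaining rounds: each of them may multiply the mean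
potential by `exp(3 η²)`, and the denominator is the level that a bad average forces at time `T`. -/
theorem main_spec {k T : ℕ} {OPT : ℝ} {xs : EuclideanSpace ℝ (Fin n)} (hn : 0 < n) (hm : 0 < m)
    (hk : ∀ i, (I.supp i).length ≤ k) (heps : I.eps ∈ Set.Ioo (0 : ℝ) 1)
    (hxs : xs ∈ cube n) (hOPT : ∀ j, inner ℝ (I.v' + I.v j) xs ≤ OPT) (hv' : ‖I.v'‖ ≤ 1 / 2)
    (hv : ∀ j, ‖I.v j‖ ≤ 1 / 2)
    (hT : ∀ t : ℕ, (t : ℝ) * I.eps * I.eps < 64 * (Nat.clog 2 (n + m) : ℝ) ↔ t < T) (d : ℕ) :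
    ∀ (t : ℕ) (A x : EuclideanSpace ℝ (Fin n)) (w : Fin m → ℝ) (s : Memory),
      Represents t A x w s → A ∈ cube n → x ∈ cube n → (∀ j, 0 < w j) → t + d = T →
      Bounded I (I.failure OPT) [.loop mainTest round] s
        (d * (roundTime n k (Nat.clog 2 (n + m)) + 13) + 13)
        (ENNReal.ofReal (Real.exp (3 * (I.eps / 8) ^ 2) ^ d *
          I.potential (I.eps / 8) OPT xs t A x w /
          Real.exp (I.eps / 8 * T * I.eps - 1 / 2 - (I.eps / 8) ^ 2 * T / 2))) := by
  have hη : 0 ≤ I.eps / 8 := by linarith [heps.1]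
  have hη1 : I.eps / 8 ≤ 1 := by linarith [heps.2]
  have hcost : mainTest.cost = 12 := rfl
  have htest : ∀ t A x w s, Represents (n := n) (m := m) t A x w s →
      (mainTest.Holds I s ↔ t < T) := by
    intro t A x w s hs
    rw [← hT]
    simp only [mainTest, Test.Holds, RealExpr.eval, NatExpr.eval, hs.round, hs.log,
      Nat.cast_ofNat]
  induction d with
  | zero =>
    intro t A x w s hs hA hx hw ht
    have ht : t = T := by omega
    subst ht
    have hex := Bounded.loop_exit (I := I) (P := round) (K := [])
      (show ¬ mainTest.Holds I s by rw [htest _ _ _ _ _ hs]; exact lt_irrefl _)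
      (Bounded.nil (τ := 0) (le_refl (I.failure OPT s)))
    refine hex.mono (by omega) ?_
    have hout : s.output n = A := by
      ext i
      exact hs.average i
    unfold Input.failure
    split_ifs with hgood
    · exact zero_le
    · have hbad : I.eps + OPT < I.objective A := by
        by_contra hcon
        rw [hout] at hgood
        exact hgood ⟨hA, not_lt.1 hcon⟩
      -- Markov's inequality in pointwise form: on a bad output the potential divided by its
      -- threshold is at least `1`.
      rw [pow_zero, one_mul, ← ENNReal.ofReal_one]
      refine ENNReal.ofReal_le_ofReal ?_
      rw [le_div_iff₀ (Real.exp_pos _), one_mul]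
      exact le_potential_of_bad hη hw t hm hbad
  | succ d ih =>
    intro t A x w s hs hA hx hw ht
    set Z := Real.exp (I.eps / 8 * T * I.eps - 1 / 2 - (I.eps / 8) ^ 2 * T / 2) with hZ
    have hZ0 : 0 < Z := Real.exp_pos _
    set E := Real.exp (3 * (I.eps / 8) ^ 2) with hE
    have hE0 : 0 < E := Real.exp_pos _
    have hr := round_spec (Φ := I.failure OPT) (K := [.loop mainTest round])
      (τ := d * (roundTime n k (Nat.clog 2 (n + m)) + 13) + 13) hn hm hk hs hw
      (g := fun l i => E ^ d * I.potential (I.eps / 8) OPT xs (t + 1) (nextAverage t A x)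
        (I.nextPoint (I.eps / 8) x l) (I.nextWeight (I.eps / 8) x w i) / Z)
      (fun l i => div_nonneg (mul_nonneg (pow_nonneg hE0.le _)
        (potential_nonneg (I.nextWeight_pos _ _ hw i) _ _)) hZ0.le)
      fun l i s' hs' => ih _ _ _ _ s' hs' (nextAverage_mem t hA hx) (I.nextPoint_mem _ _ l)
        (I.nextWeight_pos _ _ hw i) (by omega)
    refine (Bounded.loop_enter ((htest _ _ _ _ _ hs).2 (by omega)) hr).mono ?_ ?_
    · rw [hcost]
      ring_nf
      omega
    · refine ENNReal.ofReal_le_ofReal ?_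
      have hmean := mean_potential_le hn hm hη hη1 hxs hOPT hv' hv hx hw t A
      rw [← hE] at hmean
      have hsum : ∑ l, w l / (∑ l, w l) * ∑ i : Fin n, 1 / (n : ℝ) * (E ^ d *
          I.potential (I.eps / 8) OPT xs (t + 1) (nextAverage t A x)
            (I.nextPoint (I.eps / 8) x l) (I.nextWeight (I.eps / 8) x w i) / Z) =
          E ^ d / Z * ∑ l, w l / (∑ l, w l) * ∑ i : Fin n, 1 / (n : ℝ) *
            I.potential (I.eps / 8) OPT xs (t + 1) (nextAverage t A x)
              (I.nextPoint (I.eps / 8) x l) (I.nextWeight (I.eps / 8) x w i) := by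
        rw [Finset.mul_sum]
        refine Finset.sum_congr rfl fun l _ => ?_
        rw [Finset.mul_sum, Finset.mul_sum, Finset.mul_sum]
        exact Finset.sum_congr rfl fun i _ => by ring
      rw [hsum]
      refine (mul_le_mul_of_nonneg_left hmean (by positivity)).trans (le_of_eq ?_)
      rw [pow_succ]
      ring

/-! ### Failure probability and running time in terms of the logarithm -/

theorem one_le_clog (hn : 0 < n) (hm : 0 < m) : 1 ≤ Nat.clog 2 (n + m) :=
  Nat.clog_pos (by norm_num) (by omega)

theorem log_le_clog (hn : 0 < n) : Real.log (n + m) ≤ Nat.clog 2 (n + m) := by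
  have h : ((n : ℝ) + m) ≤ 2 ^ Nat.clog 2 (n + m) := by exact_mod_cast le_two_pow_clog n m
  have h1 := Real.log_le_log (by positivity) h
  rw [Real.log_pow] at h1
  have := Real.log_two_lt_d9
  nlinarith [(Nat.cast_nonneg (Nat.clog 2 (n + m)) : (0 : ℝ) ≤ _)]

theorem clog_le_log (hn : 0 < n) (hm : 0 < m) :
    (Nat.clog 2 (n + m) : ℝ) ≤ 3 * Real.log ((n : ℝ) + m + 1) := by
  set L := Nat.clog 2 (n + m) with hL
  have hL1 : 1 ≤ L := one_le_clog hn hm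
  have h1 : 2 ^ (L - 1) < n + m := Nat.pow_pred_clog_lt_self (by norm_num) (by omega)
  have h2 : (2 : ℝ) ^ (L - 1) ≤ (n : ℝ) + m + 1 := by
    have : (2 : ℝ) ^ (L - 1) < ((n + m : ℕ) : ℝ) := by exact_mod_cast h1
    push_cast at this
    linarith
  have h3 := Real.log_le_log (by positivity) h2
  rw [Real.log_pow, Nat.cast_sub hL1] at h3
  have h4 : (3 : ℝ) ≤ (n : ℝ) + m + 1 := by
    have : 2 ≤ n + m := by omega
    have : (2 : ℝ) ≤ ((n + m : ℕ) : ℝ) := by exact_mod_cast this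
    push_cast at this
    linarith
  -- This absorbs the `1` lost in `L - 1`; together with `1 / log 2 < 2` it gives the constant `3`.
  have h5 : 1 ≤ Real.log ((n : ℝ) + m + 1) := by
    rw [Real.le_log_iff_exp_le (by positivity)]
    linarith [Real.exp_one_lt_d9]
  have := Real.log_two_gt_d9
  have h6 : (1 : ℝ) ≤ L := by exact_mod_cast hL1
  push_cast at h3
  nlinarith

/-- With `u = T ε²` the exponents of the gain and the losses combine to `u (1/8 - 3/64 - 1/128) = 9
u / 128`, which is at least `9 L / 2`. This exceeds the required `3 L + 1/2`, where `3 L` accounts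
for `m² n`. -/
theorem failure_bound {T : ℕ} {L ε : ℝ} (hL1 : 1 ≤ L) (hn : 0 < n) (hm : 0 < m)
    (hL : Real.log (n + m) ≤ L) (hT : 64 * L ≤ T * ε * ε) :
    Real.exp (3 * (ε / 8) ^ 2) ^ T * (m : ℝ) ^ 2 /
      Real.exp (ε / 8 * T * ε - 1 / 2 - (ε / 8) ^ 2 * T / 2) ≤ 1 / n := by
  have hn' : (0 : ℝ) < n := by exact_mod_cast hn
  have hm' : (0 : ℝ) < m := by exact_mod_cast hm
  have h1 : (m : ℝ) ≤ Real.exp L := by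
    refine le_trans ?_ (Real.exp_le_exp.2 hL)
    rw [Real.exp_log (by positivity)]; linarith
  have h2 : (n : ℝ) ≤ Real.exp L := by
    refine le_trans ?_ (Real.exp_le_exp.2 hL)
    rw [Real.exp_log (by positivity)]; linarith
  rw [div_le_div_iff₀ (Real.exp_pos _) hn', one_mul, ← Real.exp_nat_mul]
  calc Real.exp (T * (3 * (ε / 8) ^ 2)) * (m : ℝ) ^ 2 * n
      ≤ Real.exp (T * (3 * (ε / 8) ^ 2)) * Real.exp L ^ 2 * Real.exp L := by gcongr
    _ = Real.exp (T * (3 * (ε / 8) ^ 2) + 2 * L + L) := by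
        rw [← Real.exp_nat_mul, ← Real.exp_add, ← Real.exp_add]; norm_num
    _ ≤ _ := Real.exp_le_exp.2 (by nlinarith)

/-- At most `65 L ε⁻²` rounds of cost at most `260 (n + k) L`, with `L² ≤ 9 Λ²`, give `65 · 260 · 9
= 152100` as the leading constant; the preparation costs at most `175 m L²`. -/
theorem time_bound {n m k L T : ℕ} {ε Λ : ℝ} (hn : 0 < n) (hm : 0 < m) (hL1 : 1 ≤ L)
    (hL : (L : ℝ) ≤ 3 * Λ) (hε0 : 0 < ε) (hε1 : ε < 1) (hT : (T : ℝ) ≤ 64 * L * ε⁻¹ ^ 2 + 1) :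
    ((1 + (20 * L + 20 + (1 + (100 * m + 20 + (T * (roundTime n k L + 13) + 13)))) : ℕ) : ℝ) ≤
      153000 * (((n : ℝ) + k) * ε⁻¹ ^ 2 + m) * Λ ^ 2 := by
  have hn' : (1 : ℝ) ≤ n := by exact_mod_cast hn
  have hm' : (1 : ℝ) ≤ m := by exact_mod_cast hm
  have hL' : (1 : ℝ) ≤ L := by exact_mod_cast hL1
  have hk : (0 : ℝ) ≤ k := Nat.cast_nonneg k
  have hε : 1 ≤ ε⁻¹ ^ 2 := one_le_pow₀ (one_le_inv₀ hε0 |>.2 hε1.le)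
  set e := ε⁻¹ ^ 2 with he
  have hLsq : (L : ℝ) ^ 2 ≤ 9 * Λ ^ 2 := by nlinarith
  have h1 : (T : ℝ) ≤ 65 * L * e := by nlinarith
  have h2 : ((roundTime n k L + 13 : ℕ) : ℝ) ≤ 260 * (n + k) * L := by
    unfold roundTime
    push_cast
    nlinarith [mul_le_mul hn' hL' (by norm_num) (by linarith), mul_nonneg hk (sub_nonneg.2 hL'),
      mul_nonneg (sub_nonneg.2 hn') (sub_nonneg.2 hL')]
  have h3 : (T : ℝ) * ((roundTime n k L + 13 : ℕ) : ℝ) ≤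
      (65 * L * e) * (260 * (n + k) * L) :=
    mul_le_mul h1 h2 (Nat.cast_nonneg _) (by positivity)
  have h4 : (20 * L + 100 * m + 55 : ℝ) ≤ 175 * m * L ^ 2 := by
    have h5 : (L : ℝ) ≤ L ^ 2 := by nlinarith
    have h6 : (L : ℝ) ^ 2 ≤ m * L ^ 2 := le_mul_of_one_le_left (by positivity) hm'
    have h7 : (m : ℝ) ≤ m * L ^ 2 := le_mul_of_one_le_right (by positivity) (by nlinarith)
    linarith
  have h5 : ((n : ℝ) + k) * e + m ≥ 0 := by positivity
  have h6 := mul_le_mul_of_nonneg_left hLsq h5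
  have h7 : (0 : ℝ) ≤ m * L ^ 2 := by positivity
  have h8 : 0 ≤ ((n : ℝ) + k) * e * L ^ 2 := by positivity
  push_cast at h3 ⊢
  nlinarith

theorem supp_length_le {k : ℕ} (hk : ∀ i, {j | I.v j i ≠ 0}.ncard ≤ k) (i : Fin n) :
    (I.supp i).length ≤ k := by
  classical
  refine le_trans (le_of_eq ?_) (hk i)
  have : {j | I.v j i ≠ 0} = ((I.supp i).toFinset : Set (Fin m)) := by
    ext j; simp [I.mem_supp]
  rw [this, Set.ncard_coe_finset, List.toFinset_card_of_nodup (I.supp_nodup i)]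

theorem optimize_bounded {k T : ℕ} {OPT : ℝ} {xs : EuclideanSpace ℝ (Fin n)} (hn : 0 < n)
    (hm : 0 < m) (hk : ∀ i, (I.supp i).length ≤ k) (heps : I.eps ∈ Set.Ioo (0 : ℝ) 1)
    (hxs : xs ∈ cube n) (hOPT : ∀ j, inner ℝ (I.v' + I.v j) xs ≤ OPT) (hv' : ‖I.v'‖ ≤ 1 / 2)
    (hv : ∀ j, ‖I.v j‖ ≤ 1 / 2)
    (hT : ∀ t : ℕ, (t : ℝ) * I.eps * I.eps < 64 * (Nat.clog 2 (n + m) : ℝ) ↔ t < T) :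
    Bounded I (I.failure OPT) [optimize] Memory.init
      (1 + (20 * Nat.clog 2 (n + m) + 20 + (1 + (100 * m + 20 +
        (T * (roundTime n k (Nat.clog 2 (n + m)) + 13) + 13)))))
      (ENNReal.ofReal (1 / (n : ℝ))) := by
  refine Bounded.seq (computeLog_spec _ _ _ _ fun s₁ ⟨h1, h2, h3⟩ => Bounded.seq
    (buildTree_spec hm s₁ _ _ _ _ fun s₂ ⟨g1, g2, g3, g4⟩ => ?_))
  have hrep : Represents (n := n) (m := m) 0 0 0 (fun _ => 1) s₂ :=
    ⟨g2.trans h1, g3.trans h2, fun i => by rw [g4 0 (by norm_num), h3]; rfl,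
      fun i => by rw [g4 1 (by norm_num), h3]; rfl, g1⟩
  refine (main_spec hn hm hk heps hxs hOPT hv' hv hT T 0 0 0 (fun _ => 1) s₂ hrep zero_mem_cube
    zero_mem_cube (fun _ => one_pos) (zero_add _)).mono le_rfl (ENNReal.ofReal_le_ofReal ?_)
  refine le_trans ?_ (failure_bound (T := T) (L := Nat.clog 2 (n + m)) (ε := I.eps)
    (by exact_mod_cast one_le_clog hn hm) hn hm (log_le_clog hn)
    (not_lt.1 ((not_congr (hT T)).2 (lt_irrefl T))))
  gcongr
  exact potential_start_le hxs

theorem success_of_failure {OPT v : ℝ} (hv : 0 ≤ v) {p : PMF Config}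
    (h : expect p (fun c => I.failure OPT c.mem) ≤ ENNReal.ofReal v) :
    ENNReal.ofReal (1 - v) ≤ p.toOuterMeasure
      {c | c.mem.output n ∈ cube n ∧ I.objective (c.mem.output n) ≤ I.eps + OPT} := by
  classical
  rw [ENNReal.ofReal_sub _ hv, ENNReal.ofReal_one, tsub_le_iff_right]
  refine le_trans (le_of_eq ?_) (add_le_add le_rfl h)
  rw [PMF.toOuterMeasure_apply, expect, ← ENNReal.tsum_add, ← p.tsum_coe]
  refine tsum_congr fun c => ?_
  unfold Input.failure
  by_cases hc : c.mem.output n ∈ cube n ∧ I.objective (c.mem.output n) ≤ I.eps + OPT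
  · rw [Set.indicator_of_mem (by exact hc), if_pos hc, mul_zero, add_zero]
  · rw [Set.indicator_of_notMem (by exact hc), if_neg hc, mul_one, zero_add]

end RealRAM

theorem proposition5p1 :
    ∃ (Optimize : RealRAM.Prog) (C : ℝ) (c : ℕ),
      ∀ (n m k : ℕ) (I : RealRAM.Input n m), 0 < n → 0 < m →
        (∀ j, ‖I.v j‖ ≤ 1 / 2) →
        (∀ i, {j | I.v j i ≠ 0}.ncard ≤ k) →
        ‖I.v'‖ ≤ 1 / 2 →
        I.eps ∈ Set.Ioo (0 : ℝ) 1 →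
        ∃ OPT : ℝ, IsLeast (I.objective '' RealRAM.cube n) OPT ∧
          ∃ N : ℕ,
            (∀ s ∈ (RealRAM.run I N Optimize.start).support,
              s.todo = [] ∧
              (s.time : ℝ) ≤
                C * (((n : ℝ) + k) * I.eps⁻¹ ^ 2 + m) * Real.log ((n : ℝ) + m + 1) ^ c) ∧
            ENNReal.ofReal (1 - 1 / (n : ℝ)) ≤
              (RealRAM.run I N Optimize.start).toOuterMeasure
                {s | s.mem.output n ∈ RealRAM.cube n ∧
                  I.objective (s.mem.output n) ≤ I.eps + OPT} := by
  -- Of the two logarithms, one comes from the number of rounds and one from the depth of the tree.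
  refine ⟨RealRAM.optimize, 153000, 2, fun n m k I hn hm hv hk hv' heps => ?_⟩
  obtain ⟨xs, hxs, hleast⟩ := I.exists_minimum
  refine ⟨I.objective xs, hleast, ?_⟩
  set L := Nat.clog 2 (n + m) with hL
  have hεε : 0 < I.eps * I.eps := mul_pos heps.1 heps.1
  -- With the ceiling, the main test succeeds exactly in the rounds `t < T`.
  set T := ⌈64 * (L : ℝ) / (I.eps * I.eps)⌉₊ with hTdef
  have hT : ∀ t : ℕ, (t : ℝ) * I.eps * I.eps < 64 * (L : ℝ) ↔ t < T := fun t => by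
    rw [hTdef, Nat.lt_ceil, lt_div_iff₀ hεε, mul_assoc]
  have hT1 : (T : ℝ) ≤ 64 * L * I.eps⁻¹ ^ 2 + 1 := by
    have h : 64 * (L : ℝ) / (I.eps * I.eps) = 64 * L * I.eps⁻¹ ^ 2 := by
      rw [div_eq_mul_inv, mul_inv, ← sq]
    rw [← h]
    exact (Nat.ceil_lt_add_one (by positivity)).le
  have hb := RealRAM.optimize_bounded hn hm (RealRAM.supp_length_le hk) heps hxs
    (I.inner_le_objective xs) hv' hv hT
  obtain ⟨N, hN, hfail⟩ := hb.exists_run ENNReal.ofReal_ne_top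
  refine ⟨N, fun s hs => ⟨(hN s hs).1, ?_⟩, RealRAM.success_of_failure (by positivity) hfail⟩
  refine le_trans (Nat.cast_le.2 (hN s hs).2) ?_
  exact RealRAM.time_bound hn hm (RealRAM.one_le_clog hn hm) (RealRAM.clog_le_log hn hm)
    heps.1 heps.2 hT1
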